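/- **Theorem 3.11.** Let $d\ge 1$, let $\mathcal X=[0,1]^d$, let $\mathcal H$ be the class of all functions $[0,1]^d\to[0,1]$ that are $1$-Lipschitz with respect to the sup norm, and let $\ell(\hat y,y)=|\hat y-y|$. A prediction rule $\Phi$ assigns to every $t\ge 1$ and every $x_1,\dots,x_t\in\mathcal X$, $y_1,\dots,y_{t-1}\in[0,1]$ a probability distribution $\Phi(x^t,y^{t-1})$ on $[0,1]$. Its hybrid minimax regret at horizon $T$ (unknown i.i.d. features, adaptively chosen labels) is $$\tilde r_T(\mathcal H,\Phi)=\sup_{\mu}\ \mathbb E_{x_1}\sup_{y_1\in[0,1]}\mathbb E_{\hat y_1}\cdots\mathbb E_{x_T}\sup_{y_T\in[0,1]}\mathbb E_{\hat y_T}\Big[\sum_{t=1}^T\ell(\hat y_t,y_t)-\inf_{h\in\mathcal H}\sum_{t=1}^T\ell(h(x_t),y_t)\Big],$$ where $\mu$ ranges over the Borel probability measures on $\mathcal X$, $x_t\sim\mu$ and $\hat y_t\sim\Phi(x^t,y^{t-1})$ (expectations are outer expectations where measurability is in doubt). A mixed ERM oracle returns, for labelled samples $(x_i,y_i)\in\mathcal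 X\times[0,1]$, $i\le m$, a weight $C\ge 0$, points $\tilde x_j\in\mathcal X$ and signs $\epsilon_j\in\{-1,1\}$, $j\le n$, the number $\inf_{h\in\mathcal H}\{\sum_{i\le m}\ell(h(x_i),y_i)+C\sum_{j\le n}\epsilon_jh(\tilde x_j)\}$. The rule $\Phi$ is oracle-efficient if a single randomized program of a real-number random access machine (exact real arithmetic with rational constants, fair coin flips, calls to the mixed ERM oracle; one time unit per operation, and $1$ plus the length $m+n$ of the query per oracle call) produces, on every input $(x^t,y^{t-1})$, a number with law $\Phi(x^t,y^{t-1})$, in time bounded by a fixed polynomial in $t$. Put $\alpha=\max\{\tfrac12,\tfrac{d-1}{d}\}$. 1. There are an oracle-efficient prediction rule $\Phi$ (not depending on the horizon) and constants $C\in\mathbb R$, $k\in\mathbb N$, depending only on $d$, such that $\tilde r_T(\mathcal H,\Phi)\le C\,T^{\alpha}(1+\log T)^{k}$ for all $T\ge 1$. 2. This is tight up to polylogarithmic factors: there are constants $c>0$ and $k\in\mathbb N$, depending only on $d$, such that $\tilde r_T(\mathcal H,\Phi)\ge c\,T^{\alpha}(1+\log T)^{-k}$ for all $T\ge 1$ and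 every prediction rule $\Phi$, efficient or not. -/

import Mathlib

open MeasureTheory unitInterval

noncomputable section

/-! ## The hybrid online learning game -/

/-- The absolute loss `|ŷ - y|` on `[0,1]`. -/
def absLoss (yhat y : I) : ℝ := |(yhat : ℝ) - (y : ℝ)|

/-- A prediction rule: given `(x_1,y_1), …, (x_{t-1},y_{t-1})` (in this order) and `x_t`, a
probability distribution over `[0,1]`, from which the prediction `ŷ_t` is drawn. -/
abbrev PredictionRule (X : Type) := List (X × I) → X → ProbabilityMeasure I

/-- The (outer) expectation of a bounded function `f`. It is the ordinary expectation `∫ f ∂μ` when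
`f` is integrable; its use makes the iterated expression `E sup E ⋯ E sup E` below
meaningful without any measurability assumption on the suprema or on the prediction rule. -/
def expect {Ω : Type} [MeasurableSpace Ω] (μ : Measure Ω) (f : Ω → ℝ) : ℝ :=
  sInf {r : ℝ | ∃ g : Ω → ℝ, Integrable g μ ∧ (∀ ω, f ω ≤ g ω) ∧ r = ∫ ω, g ω ∂μ}

section Game

variable {X : Type} (loss : I → I → ℝ) (H : Set (X → I))

/-- The regret of a finished game with rounds `(x_t, y_t, ŷ_t)`:
`∑ loss(ŷ_t, y_t) - inf_{h ∈ H} ∑ loss(h(x_t), y_t)`. -/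
def realizedRegret (rounds : List (X × I × I)) : ℝ :=
  (rounds.map fun r => loss r.2.2 r.2.1).sum
    - ⨅ h : H, (rounds.map fun r => loss (h.1 r.1) r.2.1).sum

/-- The value of the game against the rule `Φ` when the rounds `rounds` have been played and `n`
rounds remain: `E_{x ∼ μ} sup_y E_{ŷ ∼ Φ} ⋯ E_{x ∼ μ} sup_y E_{ŷ ∼ Φ} [regret]`, with `n` blocks. -/
def gameValue [MeasurableSpace X] (Φ : PredictionRule X) (μ : Measure X) :
    ℕ → List (X × I × I) → ℝ
  | 0, rounds => realizedRegret loss H rounds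
  | n + 1, rounds =>
      expect μ fun x => ⨆ y : I,
        expect (Φ (rounds.map fun r => (r.1, r.2.1)) x : Measure I) fun yhat =>
          gameValue Φ μ n (rounds ++ [(x, y, yhat)])

/-- The hybrid minimax regret of `Φ` at horizon `T`, against an adaptive adversary and the worst
feature distribution `μ`. -/
def hybridRegret [MeasurableSpace X] (Φ : PredictionRule X) (T : ℕ) : ℝ :=
  ⨆ μ : ProbabilityMeasure X, gameValue loss H Φ (μ : Measure X) T []

/-- The value computed by the mixed ERM oracle:
`inf_{h ∈ H} { ∑ loss(h(x_i), y_i) + C ∑ ε_j h(x̃_j) }` with signs `ε_j ∈ {-1, 1}`. -/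
def mixedERM (labelled : List (X × I)) (C : ℝ) (signed : List (X × ℤˣ)) : ℝ :=
  ⨅ h : H, ((labelled.map fun p => loss (h.1 p.1) p.2).sum
    + C * (signed.map fun p => ((p.2 : ℤ) : ℝ) * (h.1 p.1 : ℝ)).sum)

end Game

/-- The cube `[0,1]^d`; its distance is the one of the sup norm. -/
abbrev Cube (d : ℕ) := Fin d → I

/-- All 1-Lipschitz functions `[0,1]^d → [0,1]` under the sup norm. -/
def lipschitzClass (d : ℕ) : Set (Cube d → I) := {h | LipschitzWith 1 h}

/-! ## Oracle machines

A randomized random access machine over the reals. It has a memory of natural numbers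
(registers, counters, addresses), a memory of real numbers, a source of fair coin flips, and a
mixed ERM oracle. The constants of a program are natural or rational. -/

/-- A memory configuration; `coins` is the part of the random tape not read so far. -/
structure MachineState where
  natMem : ℕ → ℕ
  realMem : ℕ → ℝ
  coins : ℕ → Bool

/-- Elementary instructions. `N` is the natural memory, `R` the real memory; the real memory is
addressed through the natural one. -/
inductive Instr
  /-- `N[i] := c` -/
  | natConst (i c : ℕ)
  /-- `N[i] := N[j]` -/
  | natCopy (i j : ℕ)
  /-- `N[i] := N[j] + N[k]` -/
  | natAdd (i j k : ℕ)
  /-- `N[i] := N[j] - N[k]` (truncated) -/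
  | natSub (i j k : ℕ)
  /-- `N[i] := N[N[j]]` -/
  | natLoad (i j : ℕ)
  /-- `N[N[i]] := N[j]` -/
  | natStore (i j : ℕ)
  /-- `R[N[i]] := q` -/
  | realConst (i : ℕ) (q : ℚ)
  /-- `R[N[i]] := N[j]` -/
  | realOfNat (i j : ℕ)
  /-- `R[N[i]] := R[N[j]]` -/
  | realCopy (i j : ℕ)
  /-- `R[N[i]] := R[N[j]] + R[N[k]]` -/
  | realAdd (i j k : ℕ)
  /-- `R[N[i]] := R[N[j]] - R[N[k]]` -/
  | realSub (i j k : ℕ)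
  /-- `R[N[i]] := R[N[j]] * R[N[k]]` -/
  | realMul (i j k : ℕ)
  /-- `R[N[i]] := R[N[j]] / R[N[k]]` (and `0` if the divisor is `0`) -/
  | realDiv (i j k : ℕ)
  /-- `N[i] := 0` or `1`, by a fair coin flip -/
  | flip (i : ℕ)
  /-- `R[N[o]] :=` the answer of the mixed ERM oracle to a query with `N[m]` labelled samples
  stored from address `N[a]` on, weight `R[N[c]]`, and `N[n]` signed samples stored from address
  `N[b]` on -/
  | oracle (o m a c n b : ℕ)

/-- Tests in conditionals and loops: `N[i] ≤ N[j]` or `R[N[i]] ≤ R[N[j]]`. -/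
inductive Test
  | natLe (i j : ℕ)
  | realLe (i j : ℕ)

/-- Structured programs. -/
inductive Program
  | skip
  | instr (a : Instr)
  | seq (P Q : Program)
  | ite (b : Test) (P Q : Program)
  | loop (b : Test) (P : Program)

namespace MachineState

/-- The number in `[0,1]` stored at an address (a number outside `[0,1]` is moved to the nearest
endpoint). -/
def unitAt (s : MachineState) (a : ℕ) : I :=
  Set.projIcc (0 : ℝ) 1 zero_le_one (s.realMem a)

/-- The point of the cube whose coordinates are stored at the addresses `a, …, a + d - 1`. -/
def pointAt (d : ℕ) (s : MachineState) (a : ℕ) : Cube d := fun k => s.unitAt (a + k)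

/-- The sign stored at an address. -/
def signAt (s : MachineState) (a : ℕ) : ℤˣ := if 0 ≤ s.realMem a then 1 else -1

/-- The `m` labelled samples stored from address `a` on, each in `d + 1` consecutive cells: the
coordinates of the point, then the label. -/
def labelledAt (d : ℕ) (s : MachineState) (m a : ℕ) : List (Cube d × I) :=
  (List.range m).map fun i => (s.pointAt d (a + i * (d + 1)), s.unitAt (a + i * (d + 1) + d))

/-- The `n` signed samples stored from address `b` on, each in `d + 1` consecutive cells: the
coordinates of the point, then the sign. -/
def signedAt (d : ℕ) (s : MachineState) (n b : ℕ) : List (Cube d × ℤˣ) :=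
  (List.range n).map fun i => (s.pointAt d (b + i * (d + 1)), s.signAt (b + i * (d + 1) + d))

/-- `N[i] := v`. -/
def setNat (s : MachineState) (i v : ℕ) : MachineState :=
  { s with natMem := Function.update s.natMem i v }

/-- `R[N[i]] := v`. -/
def setReal (s : MachineState) (i : ℕ) (v : ℝ) : MachineState :=
  { s with realMem := Function.update s.realMem (s.natMem i) v }

/-- `R[N[i]]`. -/
def realAt (s : MachineState) (i : ℕ) : ℝ := s.realMem (s.natMem i)

end MachineState

section Semantics

variable {d : ℕ} (loss : I → I → ℝ) (H : Set (Cube d → I))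

/-- The effect of an instruction. -/
def Instr.apply (s : MachineState) : Instr → MachineState
  | natConst i c => s.setNat i c
  | natCopy i j => s.setNat i (s.natMem j)
  | natAdd i j k => s.setNat i (s.natMem j + s.natMem k)
  | natSub i j k => s.setNat i (s.natMem j - s.natMem k)
  | natLoad i j => s.setNat i (s.natMem (s.natMem j))
  | natStore i j => s.setNat (s.natMem i) (s.natMem j)
  | realConst i q => s.setReal i q
  | realOfNat i j => s.setReal i (s.natMem j)
  | realCopy i j => s.setReal i (s.realAt j)
  | realAdd i j k => s.setReal i (s.realAt j + s.realAt k)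
  | realSub i j k => s.setReal i (s.realAt j - s.realAt k)
  | realMul i j k => s.setReal i (s.realAt j * s.realAt k)
  | realDiv i j k => s.setReal i (s.realAt j / s.realAt k)
  | flip i => { s.setNat i (s.coins 0).toNat with coins := fun n => s.coins (n + 1) }
  | oracle o m a c n b =>
      s.setReal o (mixedERM loss H (s.labelledAt d (s.natMem m) (s.natMem a))
        (max (s.realAt c) 0) (s.signedAt d (s.natMem n) (s.natMem b)))

/-- The running time of an instruction: one unit. For an oracle call the length of the query is
charged in addition to the unit for the call itself, so that no query can be longer than the time
spent. -/
def Instr.cost (s : MachineState) : Instr → ℕ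
  | oracle _ m _ _ n _ => s.natMem m + s.natMem n + 1
  | _ => 1

/-- The meaning of a test. -/
def Test.Holds (s : MachineState) : Test → Prop
  | natLe i j => s.natMem i ≤ s.natMem j
  | realLe i j => s.realAt i ≤ s.realAt j

/-- `Exec loss H P s τ s'`: started in `s`, the program `P` halts after exactly `τ` time units, in
the state `s'`. -/
inductive Exec : Program → MachineState → ℕ → MachineState → Prop
  | skip (s : MachineState) : Exec .skip s 1 s
  | instr (a : Instr) (s : MachineState) : Exec (.instr a) s (a.cost s) (a.apply loss H s)
  | seq {P Q : Program} {s s' s'' : MachineState} {τ τ' : ℕ}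
      (hP : Exec P s τ s') (hQ : Exec Q s' τ' s'') : Exec (.seq P Q) s (τ + τ') s''
  | iteTrue {b : Test} {P Q : Program} {s s' : MachineState} {τ : ℕ}
      (hb : b.Holds s) (hP : Exec P s τ s') : Exec (.ite b P Q) s (τ + 1) s'
  | iteFalse {b : Test} {P Q : Program} {s s' : MachineState} {τ : ℕ}
      (hb : ¬ b.Holds s) (hQ : Exec Q s τ s') : Exec (.ite b P Q) s (τ + 1) s'
  | loopStop {b : Test} {P : Program} {s : MachineState}
      (hb : ¬ b.Holds s) : Exec (.loop b P) s 1 s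
  | loopStep {b : Test} {P : Program} {s s' s'' : MachineState} {τ τ' : ℕ}
      (hb : b.Holds s) (hP : Exec P s τ s') (hL : Exec (.loop b P) s' τ' s'') :
      Exec (.loop b P) s (τ + τ' + 1) s''

/-- The input: `N[0] = t`, and the cells `i (d+1), …, i (d+1) + d` of the real memory hold the
coordinates of `x_{i+1}` and the label `y_{i+1}`, for `i < t` (there is no label `y_t`; its cell
and all remaining cells hold `0`). -/
def startState (past : List (Cube d × I)) (x : Cube d) (ω : ℕ → Bool) : MachineState where
  natMem := Function.update (fun _ => 0) 0 (past.length + 1)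
  realMem := fun a =>
    if h : a % (d + 1) < d then
      match (past.map Prod.fst ++ [x])[a / (d + 1)]? with
      | some z => (z ⟨a % (d + 1), h⟩ : ℝ)
      | none => 0
    else
      match (past.map Prod.snd)[a / (d + 1)]? with
      | some y => (y : ℝ)
      | none => 0
  coins := ω

/-- The law of an infinite sequence of independent fair coin flips. -/
def coinMeasure : Measure (ℕ → Bool) :=
  Measure.infinitePi fun _ : ℕ => (PMF.uniformOfFintype Bool).toMeasure

/-- A prediction rule is oracle-efficient if one program, for every `t` and every input
`x_1, …, x_t, y_1, …, y_{t-1}`, halts within time polynomial in `t`, whatever the coin flips, and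
leaves in `R[0]` a number in `[0,1]` whose law under fair coin flips is the one prescribed by
the rule. -/
def IsOracleEfficient (Φ : PredictionRule (Cube d)) : Prop :=
  ∃ (P : Program) (p : Polynomial ℕ) (out : List (Cube d × I) → Cube d → (ℕ → Bool) → I),
    (∀ past x ω, ∃ (τ : ℕ) (s' : MachineState),
      Exec loss H P (startState past x ω) τ s' ∧ τ ≤ p.eval (past.length + 1) ∧
        s'.realMem 0 = (out past x ω : ℝ)) ∧
    ∀ past x, (Φ past x : Measure I) = coinMeasure.map (out past x)

end Semantics

end

/-! Write D = max(d, 2), so that the exponent is α = 1 - 1/D.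

Upper bound. The rule is deterministic, and its regret bound holds for every individual sequence of
points and labels, so the features need not be i.i.d. and the oracle and the coins are never
consulted. A 1-Lipschitz h is, up to 2⁻ᴷ, a sum over scales k ≤ K of increments, one for each dyadic
cell of side 2⁻ᵏ, and an increment at scale k has size at most 2⁻ᵏ. Every cell runs a
one-dimensional follow-the-regularized-leader learner for its increment, fed with the negative
subgradients ±1 of the loss. The prediction is the truncated sum of the learners whose cells contain
the current point. The learners share the step size η_t = 2⁻ᴷ with K = `scale d (t + 1)`, so that 2ᴷ
is about t^(1/D). At each scale k the comparator terms cost about 2^(kd) · 2^(-2k) · 2ᴷ, which is at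
most 2^(K(D-1)), and the gradient terms cost ∑ η_t. Both are O(T^α), as is the discretization error
∑ 2⁻ᴷ. The number of scales accounts for the single logarithm. The main steps are `ftrl_regret_le`,
`linear_regret_le` and `absLoss_sub_le`.

Efficiency. Summing the learners shows that the score is a step size times a sum over earlier
points, each correction being weighted by the number of cells shared with the current point. Shared
cells are detected by comparing coordinates with the at most t grid values a / 2ᵏ, so no floor
operation is needed; see `runs_multiscaleProgram`.

Lower bound. Let μ be uniform on N = mᵈ grid points with spacing 1/m, where the class realizes every
pattern 1/2 ± δ with δ = 1/(2m). Replacing the supremum over labels by the average over y = 0 and y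
= 1 makes every prediction lose 1/2 on average, while the best h gains δ ∑ |S_j|, where the S_j are
the coordinates of a random walk. The mean of ∑ |S_j| is at least √(NT)/2 when N ≤ T. Taking m = 1
for d = 1, and m about T^(1/d) otherwise, gives order T^α (`le_gameValue`, `rpow_le_hybridRegret`).
-/

noncomputable section

/-! ## Bounds for the outer expectation and the game value -/

section Expect

variable {Ω : Type} [MeasurableSpace Ω] {μ : Measure Ω} {f g : Ω → ℝ} {c : ℝ}

/-- The lower bound `c` keeps the set of majorant integrals bounded below; otherwise its real `sInf`
would be the default value 0. -/
theorem expect_le_integral [IsProbabilityMeasure μ] (hc : ∀ ω, c ≤ f ω) (hg : Integrable g μ)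
    (h : ∀ ω, f ω ≤ g ω) : expect μ f ≤ ∫ ω, g ω ∂μ := by
  refine csInf_le ⟨c, ?_⟩ ⟨g, hg, h, rfl⟩
  rintro r ⟨k, hk, hfk, rfl⟩
  calc c = ∫ _, c ∂μ := by simp
    _ ≤ ∫ ω, k ω ∂μ :=
      integral_mono (integrable_const c) hk fun ω => (hc ω).trans (hfk ω)

theorem integral_le_expect [IsProbabilityMeasure μ] (hg : Integrable g μ) (h : ∀ ω, g ω ≤ f ω)
    (hc : ∀ ω, f ω ≤ c) : ∫ ω, g ω ∂μ ≤ expect μ f := by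
  refine le_csInf ⟨_, fun _ => c, integrable_const c, hc, rfl⟩ ?_
  rintro r ⟨k, hk, hfk, rfl⟩
  exact integral_mono hg hk fun ω => (h ω).trans (hfk ω)

theorem abs_expect_le [IsProbabilityMeasure μ] (h : ∀ ω, |f ω| ≤ c) : |expect μ f| ≤ c := by
  rw [abs_le]
  constructor
  · have := integral_le_expect (μ := μ) (integrable_const (-c)) (fun ω => (abs_le.1 (h ω)).1)
      (fun ω => (abs_le.1 (h ω)).2)
    simpa using this
  · have := expect_le_integral (μ := μ) (fun ω => (abs_le.1 (h ω)).1) (integrable_const c)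
      (fun ω => (abs_le.1 (h ω)).2)
    simpa using this

/-- No measurability of `f` is needed: the majorant equal to `f a` at `a` and to `c` elsewhere is
almost everywhere constant for the Dirac measure. -/
theorem expect_dirac_le [MeasurableSingletonClass Ω] {a : Ω} (h : ∀ ω, |f ω| ≤ c) :
    expect (Measure.dirac a) f ≤ f a := by
  classical
  let g : Ω → ℝ := fun ω => if ω = a then f a else c
  have hg : g =ᵐ[Measure.dirac a] fun _ => f a := by
    rw [Filter.EventuallyEq, ae_dirac_eq]
    simp [g]
  have hint : Integrable g (Measure.dirac a) := (integrable_congr hg).2 (integrable_const _)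
  have := expect_le_integral (fun ω => (abs_le.1 (h ω)).1) hint (fun ω => by
    by_cases hω : ω = a
    · simp [g, hω]
    · simpa [g, hω] using (abs_le.1 (h ω)).2)
  rw [integral_congr_ae hg] at this
  simpa using this

end Expect

theorem absLoss_nonneg (a b : I) : 0 ≤ absLoss a b := abs_nonneg _

theorem absLoss_le_one (a b : I) : absLoss a b ≤ 1 :=
  abs_le.2 ⟨by linarith [a.2.1, b.2.2], by linarith [a.2.2, b.2.1]⟩

theorem List.sum_map_mem_Icc {α : Type} (l : List α) (f : α → ℝ) (h0 : ∀ a, 0 ≤ f a)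
    (h1 : ∀ a, f a ≤ 1) : 0 ≤ (l.map f).sum ∧ (l.map f).sum ≤ l.length := by
  induction l with
  | nil => simp
  | cons a l ih =>
    simp only [List.map_cons, List.sum_cons, List.length_cons]
    push_cast
    exact ⟨by linarith [h0 a, ih.1], by linarith [h1 a, ih.2]⟩

section Bounds

variable {X : Type} {H : Set (X → I)}

theorem bddBelow_cumulativeLoss (rounds : List (X × I × I)) :
    BddBelow (Set.range fun h : H => (rounds.map fun r => absLoss (h.1 r.1) r.2.1).sum) := by
  refine ⟨0, ?_⟩
  rintro _ ⟨h, rfl⟩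
  exact (List.sum_map_mem_Icc _ _ (fun _ => absLoss_nonneg _ _) fun _ => absLoss_le_one _ _).1

theorem abs_realizedRegret_le (hH : H.Nonempty) (rounds : List (X × I × I)) :
    |realizedRegret absLoss H rounds| ≤ rounds.length := by
  obtain ⟨h₀, hh₀⟩ := hH
  have h1 := List.sum_map_mem_Icc rounds (fun r => absLoss r.2.2 r.2.1)
    (fun _ => absLoss_nonneg _ _) fun _ => absLoss_le_one _ _
  have h2 : 0 ≤ ⨅ h : H, (rounds.map fun r => absLoss (h.1 r.1) r.2.1).sum :=
    Real.iInf_nonneg fun h => (List.sum_map_mem_Icc _ _ (fun _ => absLoss_nonneg _ _)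
      fun _ => absLoss_le_one _ _).1
  have h3 : (⨅ h : H, (rounds.map fun r => absLoss (h.1 r.1) r.2.1).sum) ≤ rounds.length :=
    (ciInf_le (bddBelow_cumulativeLoss rounds) ⟨h₀, hh₀⟩).trans
      (List.sum_map_mem_Icc _ _ (fun _ => absLoss_nonneg _ _) fun _ => absLoss_le_one _ _).2
  rw [realizedRegret, abs_le]
  exact ⟨by linarith [h1.1], by linarith [h1.2]⟩

variable [MeasurableSpace X]

/-- Each round changes the regret by at most 1. This boundedness makes the real suprema and infima
in the game genuine rather than default values. -/
theorem abs_gameValue_le (hH : H.Nonempty) (Φ : PredictionRule X) (μ : Measure X)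
    [IsProbabilityMeasure μ] (n : ℕ) (rounds : List (X × I × I)) :
    |gameValue absLoss H Φ μ n rounds| ≤ n + rounds.length := by
  induction n generalizing rounds with
  | zero => simpa [gameValue] using abs_realizedRegret_le hH rounds
  | succ n ih =>
    rw [gameValue]
    refine abs_expect_le fun x => ?_
    have key : ∀ y : I, |expect (Φ (rounds.map fun r => (r.1, r.2.1)) x : Measure I) fun yhat =>
        gameValue absLoss H Φ μ n (rounds ++ [(x, y, yhat)])| ≤
          ((n + 1 : ℕ) : ℝ) + rounds.length := fun y => abs_expect_le fun yhat => by
      have := ih (rounds ++ [(x, y, yhat)])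
      simp only [List.length_append, List.length_singleton] at this
      push_cast at this ⊢
      linarith
    rw [abs_le]
    constructor
    · refine le_trans (abs_le.1 (key 0)).1 (le_ciSup (f := fun y : I =>
        expect (Φ (rounds.map fun r => (r.1, r.2.1)) x : Measure I) fun yhat =>
        gameValue absLoss H Φ μ n (rounds ++ [(x, y, yhat)])) ?_ 0)
      exact ⟨_, Set.forall_mem_range.2 fun y => (abs_le.1 (key y)).2⟩
    · exact ciSup_le fun y => (abs_le.1 (key y)).2

theorem gameValue_succ_bddAbove (hH : H.Nonempty) (Φ : PredictionRule X) (μ : Measure X)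
    [IsProbabilityMeasure μ] (n : ℕ) (rounds : List (X × I × I)) (x : X) :
    BddAbove (Set.range fun y : I =>
      expect (Φ (rounds.map fun r => (r.1, r.2.1)) x : Measure I) fun yhat =>
        gameValue absLoss H Φ μ n (rounds ++ [(x, y, yhat)])) := by
  refine ⟨n + (rounds.length + 1), Set.forall_mem_range.2 fun y => ?_⟩
  refine (abs_le.1 (abs_expect_le fun yhat => ?_)).2
  simpa using abs_gameValue_le hH Φ μ n (rounds ++ [(x, y, yhat)])

theorem gameValue_le_hybridRegret (hH : H.Nonempty) (Φ : PredictionRule X)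
    (μ : ProbabilityMeasure X) (T : ℕ) :
    gameValue absLoss H Φ (μ : Measure X) T [] ≤ hybridRegret absLoss H Φ T := by
  refine le_ciSup (f := fun μ : ProbabilityMeasure X =>
    gameValue absLoss H Φ (μ : Measure X) T []) ⟨T, Set.forall_mem_range.2 fun ν => ?_⟩ μ
  simpa using (abs_le.1 (abs_gameValue_le hH Φ (ν : Measure X) T [])).2

end Bounds

/-! ## Deterministic rules -/

section Deterministic

variable {X : Type} {H : Set (X → I)}

/-- The rule that predicts `f past x` with certainty. -/
def diracRule (f : List (X × I) → X → I) : PredictionRule X :=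
  fun past x => ⟨Measure.dirac (f past x), inferInstance⟩

/-- The first `t` samples of a sequence. -/
def samples (x : ℕ → X) (y : ℕ → I) (t : ℕ) : List (X × I) :=
  (List.range t).map fun i => (x i, y i)

/-- The first `t` rounds of the game on a sequence, when the predictions are those of `f`. -/
def roundsOf (f : List (X × I) → X → I) (x : ℕ → X) (y : ℕ → I) (t : ℕ) : List (X × I × I) :=
  (List.range t).map fun i => (x i, y i, f (samples x y i) (x i))

theorem samples_congr {x x' : ℕ → X} {y y' : ℕ → I} {t : ℕ} (hx : ∀ i < t, x i = x' i)
    (hy : ∀ i < t, y i = y' i) : samples x y t = samples x' y' t := by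
  refine List.map_congr_left fun i hi => ?_
  rw [List.mem_range] at hi
  rw [hx i hi, hy i hi]

theorem roundsOf_congr (f : List (X × I) → X → I) {x x' : ℕ → X} {y y' : ℕ → I} {t : ℕ}
    (hx : ∀ i < t, x i = x' i) (hy : ∀ i < t, y i = y' i) :
    roundsOf f x y t = roundsOf f x' y' t := by
  refine List.map_congr_left fun i hi => ?_
  rw [List.mem_range] at hi
  rw [hx i hi, hy i hi, samples_congr (fun j hj => hx j (hj.trans hi))
    (fun j hj => hy j (hj.trans hi))]

theorem roundsOf_map_samples (f : List (X × I) → X → I) (x : ℕ → X) (y : ℕ → I) (t : ℕ) :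
    (roundsOf f x y t).map (fun r => (r.1, r.2.1)) = samples x y t := by
  simp [roundsOf, samples, Function.comp_def]

variable [MeasurableSpace X]

/-- Against a deterministic rule every play of the game is `roundsOf f x y T` for some sequences, so
a bound on all sequences survives each expectation and supremum. Histories are prefixes of infinite
sequences; a new round overwrites the entry at index `t`. -/
theorem gameValue_diracRule_le (hH : H.Nonempty) (f : List (X × I) → X → I) (μ : Measure X)
    [IsProbabilityMeasure μ] {T : ℕ} {B : ℝ}
    (hB : ∀ x y, realizedRegret absLoss H (roundsOf f x y T) ≤ B) (n t : ℕ) (hn : t + n = T)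
    (x : ℕ → X) (y : ℕ → I) :
    gameValue absLoss H (diracRule f) μ n (roundsOf f x y t) ≤ B := by
  induction n generalizing t x y with
  | zero =>
    obtain rfl : t = T := by omega
    exact hB x y
  | succ n ih =>
    rw [gameValue]
    have hbd : ∀ x' : X, ∀ y' yhat : I, |gameValue absLoss H (diracRule f) μ n
        (roundsOf f x y t ++ [(x', y', yhat)])| ≤ n + (t + 1) := fun x' y' yhat => by
      have := abs_gameValue_le hH (diracRule f) μ n (roundsOf f x y t ++ [(x', y', yhat)])
      simpa [roundsOf] using this
    have step : ∀ x' : X, (⨆ y' : I, expect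
        (diracRule f ((roundsOf f x y t).map fun r => (r.1, r.2.1)) x' : Measure I) fun yhat =>
          gameValue absLoss H (diracRule f) μ n (roundsOf f x y t ++ [(x', y', yhat)])) ≤ B := by
      refine fun x' => ciSup_le fun y' => ?_
      refine (expect_dirac_le (hbd x' y')).trans ?_
      have h := ih (t + 1) (by omega) (Function.update x t x') (Function.update y t y')
      have e : roundsOf f (Function.update x t x') (Function.update y t y') (t + 1) =
          roundsOf f x y t ++ [(x', y', f (samples x y t) x')] := by
        have hx : ∀ i < t, Function.update x t x' i = x i := fun i hi => by simp [hi.ne]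
        have hy : ∀ i < t, Function.update y t y' i = y i := fun i hi => by simp [hi.ne]
        rw [← roundsOf_congr f hx hy, ← samples_congr hx hy]
        simp [roundsOf, List.range_succ]
      rw [e] at h
      rwa [roundsOf_map_samples]
    have hlow : ∀ x' : X, -((n : ℝ) + (t + 1)) ≤ ⨆ y' : I, expect
        (diracRule f ((roundsOf f x y t).map fun r => (r.1, r.2.1)) x' : Measure I) fun yhat =>
          gameValue absLoss H (diracRule f) μ n (roundsOf f x y t ++ [(x', y', yhat)]) := by
      intro x'
      exact (abs_le.1 (abs_expect_le (hbd x' 0))).1.trans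
        (le_ciSup (gameValue_succ_bddAbove hH (diracRule f) μ n (roundsOf f x y t) x') 0)
    simpa using expect_le_integral (μ := μ) hlow (integrable_const B) step

theorem hybridRegret_diracRule_le (hH : H.Nonempty) (f : List (X × I) → X → I) [Nonempty X]
    {T : ℕ} {B : ℝ} (hB : ∀ x y, realizedRegret absLoss H (roundsOf f x y T) ≤ B) :
    hybridRegret absLoss H (diracRule f) T ≤ B := by
  obtain ⟨x₀⟩ := ‹Nonempty X›
  have : Nonempty (ProbabilityMeasure X) := ⟨⟨Measure.dirac x₀, inferInstance⟩⟩
  refine ciSup_le fun μ => ?_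
  simpa [roundsOf] using gameValue_diracRule_le hH f (μ : Measure X) hB T 0 (by simp)
    (fun _ => x₀) (fun _ => 0)

end Deterministic

/-! ## The lower bound -/

section Lower

variable {X : Type} {ι : Type}

/-- The sum of the signs `2 y - 1` of the labels at the point `c j`. -/
def signSum [DecidableEq X] (c : ι → X) (rounds : List (X × I × I)) (j : ι) : ℝ :=
  (rounds.map fun r => if r.1 = c j then 2 * (r.2.1 : ℝ) - 1 else 0).sum

/-- A lower bound for the mean of `∑ j, (A S_j ^ 2 - B S_j ^ 4)` after `n` steps of a random walk
which at each step changes one uniformly chosen coordinate by a random sign. -/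
def walkPotential [Fintype ι] (A B : ℝ) (n : ℕ) (S : ι → ℝ) : ℝ :=
  ∑ j, (A * (S j ^ 2 + n / Fintype.card ι) - B * (S j ^ 4
    + n / Fintype.card ι * (6 * S j ^ 2 + 1) + 3 * n * (n - 1) / (Fintype.card ι : ℝ) ^ 2))

/-! ### A random walk and a quartic minorant of the absolute value -/

variable [Fintype ι]

/-- The quartic touches |s| at |s| = L: the difference equals |s| (|s| - L)² (|s| + 2L) / (2L³).
Only second and fourth moments of the walk are then needed. -/
theorem sub_le_abs_of_pos {L : ℝ} (hL : 0 < L) (s : ℝ) :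
    3 / (2 * L) * s ^ 2 - 1 / (2 * L ^ 3) * s ^ 4 ≤ |s| := by
  have h : 0 ≤ |s| * (|s| - L) ^ 2 * (|s| + 2 * L) / (2 * L ^ 3) := by positivity
  have e : |s| - (3 / (2 * L) * |s| ^ 2 - 1 / (2 * L ^ 3) * |s| ^ 4) =
      |s| * (|s| - L) ^ 2 * (|s| + 2 * L) / (2 * L ^ 3) := by
    field_simp
    ring
  have h4 : |s| ^ 4 = s ^ 4 := by
    rw [show (4 : ℕ) = 2 * 2 by norm_num, pow_mul, pow_mul, sq_abs]
  rw [sq_abs, h4] at e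
  linarith

theorem walkPotential_zero_le [Nonempty ι] {L : ℝ} (hL : 0 < L) (S : ι → ℝ) :
    walkPotential (3 / (2 * L)) (1 / (2 * L ^ 3)) 0 S ≤ ∑ j, |S j| := by
  unfold walkPotential
  refine Finset.sum_le_sum fun j _ => ?_
  simpa using sub_le_abs_of_pos hL (S j)

/-- Here L is twice the standard deviation √(T/N) of a coordinate. The quadratic term contributes
3L/8 and the quartic one at most L/8, the latter using L ≥ 2, that is N ≤ T. The total is at least N
· L/4 = √(NT)/2. -/
theorem sqrt_le_walkPotential [Nonempty ι] {T : ℕ} (hT : Fintype.card ι ≤ T) {L : ℝ} (hL : 0 < L)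
    (hL2 : L ^ 2 = 4 * (T / Fintype.card ι)) :
    √(Fintype.card ι * T) / 2 ≤
      walkPotential (ι := ι) (3 / (2 * L)) (1 / (2 * L ^ 3)) T 0 := by
  have hN : (0 : ℝ) < Fintype.card ι := by exact_mod_cast Fintype.card_pos
  have hTN : (Fintype.card ι : ℝ) ≤ T := by exact_mod_cast hT
  set N := (Fintype.card ι : ℝ) with hNdef
  have hT0 : (0 : ℝ) < T := hN.trans_le hTN
  have hLT : (T : ℝ) = N * L ^ 2 / 4 := by rw [hL2]; field_simp
  have hLN : 4 ≤ L ^ 2 := by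
    rw [hL2]
    have : 1 ≤ (T : ℝ) / N := (one_le_div hN).2 hTN
    linarith
  have e : √(N * T) = N * L / 2 := by
    rw [hLT, show N * (N * L ^ 2 / 4) = (N * L / 2) ^ 2 by ring]
    exact Real.sqrt_sq (by positivity)
  unfold walkPotential
  simp only [Pi.zero_apply, Finset.sum_const, Finset.card_univ, nsmul_eq_mul, ← hNdef]
  rw [e]
  have h1 : (T : ℝ) / N = L ^ 2 / 4 := by rw [hL2]; ring
  have h2 : 3 * (T : ℝ) * (T - 1) / N ^ 2 ≤ 3 * (L ^ 2 / 4) ^ 2 := by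
    rw [← h1, div_pow, ← mul_div_assoc]
    refine div_le_div_of_nonneg_right ?_ (by positivity)
    nlinarith
  have h3 : 1 / (2 * L ^ 3) * ((0 : ℝ) ^ 4 + T / N * (6 * 0 ^ 2 + 1) + 3 * T * (T - 1) / N ^ 2) ≤
      1 / (2 * L ^ 3) * (L ^ 4 / 4) := by
    refine mul_le_mul_of_nonneg_left ?_ (by positivity)
    rw [h1]
    nlinarith
  have h4 : 1 / (2 * L ^ 3) * (L ^ 4 / 4) = L / 8 := by field_simp; norm_num
  have h5 : 3 / (2 * L) * ((0 : ℝ) ^ 2 + T / N) = 3 * L / 8 := by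
    rw [h1]; field_simp; ring
  rw [h5]
  rw [h4] at h3
  nlinarith

variable [DecidableEq ι]

theorem walkPotential_average (A B : ℝ) (n : ℕ) (S : ι → ℝ) (j : ι) :
    (walkPotential A B n (S + Pi.single j 1) + walkPotential A B n (S + Pi.single j (-1))) / 2 =
      walkPotential A B n S
        + (A - B * (6 * S j ^ 2 + 1 + n / Fintype.card ι * 6)) := by
  unfold walkPotential
  rw [← Finset.sum_add_distrib, Finset.sum_div, ← sub_eq_iff_eq_add', ← Finset.sum_sub_distrib,
    Finset.sum_eq_single j]
  · simp only [Pi.add_apply, Pi.single_eq_same]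
    ring
  · intro i _ hi
    simp only [Pi.add_apply, Pi.single_eq_of_ne hi]
    ring
  · simp

/-- The recursion is an exact identity: the potential is the mean of the quartic expression over the
remaining steps, so no estimate is lost in the backward induction. -/
theorem walkPotential_succ [Nonempty ι] (A B : ℝ) (n : ℕ) (S : ι → ℝ) :
    walkPotential A B (n + 1) S = (∑ j, (walkPotential A B n (S + Pi.single j 1)
      + walkPotential A B n (S + Pi.single j (-1))) / 2) / Fintype.card ι := by
  have hN : (Fintype.card ι : ℝ) ≠ 0 := by exact_mod_cast Fintype.card_ne_zero
  rw [Finset.sum_congr rfl fun j _ => walkPotential_average A B n S j, Finset.sum_add_distrib,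
    add_div, Finset.sum_const, Finset.card_univ, nsmul_eq_mul, mul_div_cancel_left₀ _ hN,
    Finset.sum_div]
  unfold walkPotential
  rw [← Finset.sum_add_distrib]
  refine Finset.sum_congr rfl fun j _ => ?_
  push_cast
  field_simp
  ring


/-! ### Uniform points and binary labels against a shattered class -/

/-- The uniform distribution on the points `c j`. -/
def uniformOn [Nonempty ι] [MeasurableSpace X] (c : ι → X) : ProbabilityMeasure X :=
  letI : MeasurableSpace ι := ⊤
  ⟨(PMF.uniformOfFintype ι).toMeasure.map c,
    Measure.isProbabilityMeasure_map (measurable_of_finite c).aemeasurable⟩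

omit [DecidableEq ι] in
-- Any integrable majorant has as its integral the average of its values at the `c j`. The index
-- type carries the σ-algebra `⊤`, so `c` is measurable whatever the σ-algebra of `X`.
theorem average_le_expect [Nonempty ι] [MeasurableSpace X] (c : ι → X) {f : X → ℝ}
    {b : ℝ} (hb : ∀ x, f x ≤ b) {a : ι → ℝ} (h : ∀ j, a j ≤ f (c j)) :
    (∑ j, a j) / Fintype.card ι ≤ expect (uniformOn c : Measure X) f := by
  let _ : MeasurableSpace ι := ⊤
  refine le_csInf ⟨_, fun _ => b, integrable_const b, hb, rfl⟩ ?_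
  rintro r ⟨g, hg, hfg, rfl⟩
  have e : ∫ x, g x ∂(uniformOn c : Measure X) = (∑ j, g (c j)) / Fintype.card ι := by
    change ∫ x, g x ∂((PMF.uniformOfFintype ι).toMeasure.map c) = _
    rw [integral_map (measurable_of_finite c).aemeasurable hg.aestronglyMeasurable,
      PMF.integral_eq_sum, Finset.sum_div]
    refine Finset.sum_congr rfl fun j _ => ?_
    simp [div_eq_inv_mul]
  rw [e]
  gcongr with j
  exact (h j).trans (hfg _)

omit [Fintype ι] in
theorem signSum_append [DecidableEq X] {c : ι → X} (hc : Function.Injective c)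
    (rounds : List (X × I × I)) (j : ι) (y yhat : I) :
    signSum c (rounds ++ [(c j, y, yhat)]) =
      signSum c rounds + Pi.single j (2 * (y : ℝ) - 1) := by
  funext i
  by_cases h : i = j
  · subst h
    simp [signSum]
  · have : c j ≠ c i := fun h' => h (hc h').symm
    simp [signSum, this, h]

/-- The rounds have been played at the points `c j`, with labels `0` and `1`. -/
def IsBinaryOn (c : ι → X) (rounds : List (X × I × I)) : Prop :=
  ∀ r ∈ rounds, (∃ j, r.1 = c j) ∧ (r.2.1 = 0 ∨ r.2.1 = 1)

/-- For y in {0, 1} and |δe| ≤ 1/2 one has |1/2 + δe - y| = 1/2 - δe(2y - 1), so the loss is affine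
in the pattern `e`. -/
theorem cumulativeLoss_eq [DecidableEq X] {c : ι → X} (hc : Function.Injective c) {δ : ℝ}
    (hδ : δ ≤ 1 / 2) (h : X → I) (e : ι → ℝ) (he : ∀ j, |e j| ≤ 1) (hδ0 : 0 ≤ δ)
    (hh : ∀ j, (h (c j) : ℝ) = 1 / 2 + δ * e j) (rounds : List (X × I × I))
    (hr : IsBinaryOn c rounds) :
    (rounds.map fun r => absLoss (h r.1) r.2.1).sum =
      (rounds.length : ℝ) / 2 - δ * ∑ j, e j * signSum c rounds j := by
  induction rounds with
  | nil => simp [signSum]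
  | cons r rounds ih =>
    have ih := ih fun r' hr' => hr r' (List.mem_cons_of_mem _ hr')
    obtain ⟨⟨j, hj⟩, hy⟩ := hr r List.mem_cons_self
    have hs : ∀ i, signSum c (r :: rounds) i =
        (if i = j then 2 * (r.2.1 : ℝ) - 1 else 0) + signSum c rounds i := by
      intro i
      simp only [signSum, List.map_cons, List.sum_cons, hj, hc.eq_iff, eq_comm]
    simp only [List.map_cons, List.sum_cons, List.length_cons, ih, hs, mul_add,
      Finset.sum_add_distrib, mul_ite, mul_zero, Finset.sum_ite_eq', Finset.mem_univ, if_true]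
    have hle : |δ * e j| ≤ 1 / 2 := by
      rw [abs_mul, abs_of_nonneg hδ0]
      nlinarith [he j, abs_nonneg (e j)]
    have hle' := abs_le.1 hle
    have : absLoss (h r.1) r.2.1 = 1 / 2 - δ * (e j * (2 * (r.2.1 : ℝ) - 1)) := by
      rw [absLoss, hj, hh]
      rcases hy with hy | hy
      · rw [hy, abs_of_nonneg]
        · simp only [Set.Icc.coe_zero]; ring
        · simp only [Set.Icc.coe_zero]; linarith
      · rw [hy, abs_of_nonpos]
        · simp only [Set.Icc.coe_one]; ring
        · simp only [Set.Icc.coe_one]; linarith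
    rw [this]
    push_cast
    ring

/-- The class `H` contains all functions with values `1 / 2 ± δ` at the points `c j`. -/
def Shatters (H : Set (X → I)) (c : ι → X) (δ : ℝ) : Prop :=
  ∀ e : ι → ℝ, (∀ j, |e j| = 1) → ∃ h ∈ H, ∀ j, (h (c j) : ℝ) = 1 / 2 + δ * e j

/-- The comparator takes the majority label's side at each point, `e j` being the sign of `signSum c
rounds j`. -/
theorem le_realizedRegret [DecidableEq X] {H : Set (X → I)} {c : ι → X}
    (hc : Function.Injective c)
    {δ : ℝ} (hδ0 : 0 ≤ δ) (hδ : δ ≤ 1 / 2) (hH : Shatters H c δ) (rounds : List (X × I × I))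
    (hr : IsBinaryOn c rounds) :
    (rounds.map fun r => absLoss r.2.2 r.2.1).sum - (rounds.length : ℝ) / 2
      + δ * ∑ j, |signSum c rounds j| ≤ realizedRegret absLoss H rounds := by
  let e : ι → ℝ := fun j => if 0 ≤ signSum c rounds j then 1 else -1
  have he : ∀ j, |e j| = 1 := fun j => by
    by_cases h : 0 ≤ signSum c rounds j <;> simp [e, h]
  obtain ⟨h, hhH, hh⟩ := hH e he
  have h1 := ciInf_le (bddBelow_cumulativeLoss (H := H) rounds) ⟨h, hhH⟩
  simp only [] at h1
  rw [cumulativeLoss_eq hc hδ h e (fun j => (he j).le) hδ0 hh rounds hr] at h1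
  have h2 : ∀ j, e j * signSum c rounds j = |signSum c rounds j| := fun j => by
    by_cases h : 0 ≤ signSum c rounds j
    · simp [e, h, abs_of_nonneg h]
    · simp [e, h, abs_of_neg (not_le.1 h)]
  simp only [h2] at h1
  rw [realizedRegret]
  linarith

theorem continuous_absLoss (y : I) : Continuous fun yhat : I => absLoss yhat y := by
  unfold absLoss
  fun_prop

/-- Backward induction: the supremum over labels dominates the average over 0 and 1. Under this
average the new loss is exactly 1/2 for every law of the prediction, and the potential averages to
its value one step earlier. -/
theorem le_gameValue [DecidableEq X] [Nonempty ι] [MeasurableSpace X] {H : Set (X → I)}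
    (hne : H.Nonempty) {c : ι → X} (hc : Function.Injective c) {δ : ℝ} (hδ0 : 0 ≤ δ)
    (hδ : δ ≤ 1 / 2) (hH : Shatters H c δ) {L : ℝ} (hL : 0 < L) (Φ : PredictionRule X)
    (n : ℕ) (rounds : List (X × I × I)) (hr : IsBinaryOn c rounds) :
    (rounds.map fun r => absLoss r.2.2 r.2.1).sum - (rounds.length : ℝ) / 2
      + δ * walkPotential (3 / (2 * L)) (1 / (2 * L ^ 3)) n (signSum c rounds) ≤
        gameValue absLoss H Φ (uniformOn c : Measure X) n rounds := by
  induction n generalizing rounds with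
  | zero =>
    rw [gameValue]
    refine le_trans ?_ (le_realizedRegret hc hδ0 hδ hH rounds hr)
    gcongr
    exact walkPotential_zero_le hL _
  | succ n ih =>
    set A := 3 / (2 * L)
    set B := 1 / (2 * L ^ 3)
    set Λ := (rounds.map fun r => absLoss r.2.2 r.2.1).sum - (rounds.length : ℝ) / 2 with hΛ
    have hN : (Fintype.card ι : ℝ) ≠ 0 := by exact_mod_cast Fintype.card_ne_zero
    have e : Λ + δ * walkPotential A B (n + 1) (signSum c rounds) =
        (∑ j, (Λ + δ * ((walkPotential A B n (signSum c rounds + Pi.single j 1)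
          + walkPotential A B n (signSum c rounds + Pi.single j (-1))) / 2)))
          / Fintype.card ι := by
      rw [Finset.sum_add_distrib, ← Finset.mul_sum, walkPotential_succ, Finset.sum_const,
        Finset.card_univ, nsmul_eq_mul, add_div, mul_div_cancel_left₀ _ hN, mul_div_assoc]
    rw [e, gameValue]
    have hup : ∀ x y, |expect (Φ (rounds.map fun r => (r.1, r.2.1)) x : Measure I) fun yhat =>
        gameValue absLoss H Φ (uniformOn c : Measure X) n (rounds ++ [(x, y, yhat)])| ≤
          n + (rounds.length + 1) := fun x y => abs_expect_le fun yhat => by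
      simpa using abs_gameValue_le hne Φ (uniformOn c : Measure X) n (rounds ++ [(x, y, yhat)])
    refine average_le_expect c (b := n + (rounds.length + 1))
      (fun x => ciSup_le fun y => (abs_le.1 (hup x y)).2) fun j => ?_
    set ν : Measure I := (Φ (rounds.map fun r => (r.1, r.2.1)) (c j) : Measure I)
    have hint : ∀ y : I, Integrable (fun yhat : I => absLoss yhat y) ν := fun y =>
      Integrable.of_bound (continuous_absLoss y).aestronglyMeasurable 1
        (Filter.Eventually.of_forall fun a => by
          rw [Real.norm_eq_abs, abs_of_nonneg (absLoss_nonneg _ _)]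
          exact absLoss_le_one _ _)
    have low : ∀ y : I, y = 0 ∨ y = 1 →
        Λ - 1 / 2 + δ * walkPotential A B n (signSum c rounds + Pi.single j (2 * (y : ℝ) - 1))
          + ∫ yhat, absLoss yhat y ∂ν ≤
        ⨆ y : I, expect ν fun yhat =>
          gameValue absLoss H Φ (uniformOn c : Measure X) n (rounds ++ [(c j, y, yhat)]) := by
      intro y hy
      refine le_trans ?_ (le_ciSup (gameValue_succ_bddAbove hne Φ _ n rounds (c j)) y)
      have hi := integral_le_expect (μ := ν)
        (g := fun yhat => (Λ - 1 / 2 + δ * walkPotential A B n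
          (signSum c rounds + Pi.single j (2 * (y : ℝ) - 1))) + absLoss yhat y)
        (f := fun yhat =>
          gameValue absLoss H Φ (uniformOn c : Measure X) n (rounds ++ [(c j, y, yhat)]))
        (c := n + (rounds.length + 1))
        ((integrable_const _).add (hint y)) (fun yhat => by
          have := ih (rounds ++ [(c j, y, yhat)]) (by
            intro r hr'
            rw [List.mem_append, List.mem_singleton] at hr'
            rcases hr' with h | rfl
            · exact hr r h
            · exact ⟨⟨j, rfl⟩, hy⟩)
          rw [signSum_append hc] at this
          simp only [List.map_append, List.map_cons, List.map_nil, List.sum_append,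
            List.sum_singleton, List.length_append, List.length_singleton] at this
          push_cast at this
          rw [hΛ]
          linarith) (fun yhat => by
          simpa using (abs_le.1 (abs_gameValue_le hne Φ (uniformOn c : Measure X) n
            (rounds ++ [(c j, y, yhat)]))).2)
      rw [integral_add (integrable_const _) (hint y)] at hi
      simpa using hi
    have hsum : ∫ yhat, absLoss yhat 0 ∂ν + ∫ yhat, absLoss yhat 1 ∂ν = 1 := by
      rw [← integral_add (hint 0) (hint 1)]
      have : ∀ a : I, absLoss a 0 + absLoss a 1 = 1 := fun a => by
        simp only [absLoss, Set.Icc.coe_zero, Set.Icc.coe_one, sub_zero]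
        rw [abs_of_nonneg a.2.1, abs_of_nonpos (by linarith [a.2.2])]
        ring
      simp [this]
    have h0 := low 0 (Or.inl rfl)
    have h1 := low 1 (Or.inr rfl)
    norm_num at h0 h1
    linarith

theorem sqrt_le_hybridRegret [DecidableEq X] [Nonempty ι] [MeasurableSpace X] {H : Set (X → I)}
    (hne : H.Nonempty) {c : ι → X} (hc : Function.Injective c) {δ : ℝ} (hδ0 : 0 ≤ δ)
    (hδ : δ ≤ 1 / 2) (hH : Shatters H c δ) {T : ℕ} (hT : Fintype.card ι ≤ T)
    (Φ : PredictionRule X) :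
    δ * (√(Fintype.card ι * T) / 2) ≤ hybridRegret absLoss H Φ T := by
  have hN : (0 : ℝ) < Fintype.card ι := by exact_mod_cast Fintype.card_pos
  have hT0 : (0 : ℝ) < T := hN.trans_le (by exact_mod_cast hT)
  have hq : 0 < 4 * ((T : ℝ) / Fintype.card ι) := by positivity
  have h1 := le_gameValue hne hc hδ0 hδ hH (Real.sqrt_pos.2 hq) Φ T [] (by simp [IsBinaryOn])
  have h2 := sqrt_le_walkPotential hT (Real.sqrt_pos.2 hq) (Real.sq_sqrt hq.le)
  refine le_trans ?_ (h1.trans (gameValue_le_hybridRegret hne Φ (uniformOn c) T))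
  have e : signSum c ([] : List (X × I × I)) = 0 := by
    funext j
    simp [signSum]
  rw [e]
  simp only [List.map_nil, List.sum_nil, List.length_nil, Nat.cast_zero, zero_div, sub_zero,
    zero_add]
  gcongr

end Lower

/-! ## The lower bound for Lipschitz functions -/

/-- The point `j / m` of the cube. -/
def gridPoint {d m : ℕ} (j : Fin d → Fin m) : Cube d :=
  fun i => ⟨(j i : ℝ) / m, by positivity, div_le_one_of_le₀ (by exact_mod_cast (j i).2.le)
    (by positivity)⟩

theorem one_div_le_dist_gridPoint {d m : ℕ} {j j' : Fin d → Fin m} (h : j ≠ j') :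
    1 / (m : ℝ) ≤ dist (gridPoint j) (gridPoint j') := by
  obtain ⟨i, hi⟩ := Function.ne_iff.1 h
  refine le_trans ?_ (dist_le_pi_dist _ _ i)
  have hm : (0 : ℝ) < m := by exact_mod_cast (j i).pos
  rw [Subtype.dist_eq, Real.dist_eq]
  simp only [gridPoint]
  rw [← sub_div, abs_div, abs_of_pos hm]
  gcongr
  have : ((j i : ℕ) : ℤ) - (j' i : ℕ) ≠ 0 := fun h0 => hi (Fin.ext (by omega))
  have := Int.one_le_abs this
  exact_mod_cast this

/-- Values 1/2 ± 1/(2m) differ by at most 1/m, the separation of the grid. The prescribed values are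
therefore 1-Lipschitz on the grid, and extending them and then clamping to [0,1] preserves this. -/
theorem shatters_gridPoint (d : ℕ) {m : ℕ} (hm : 1 ≤ m) :
    Shatters (lipschitzClass d) (gridPoint (d := d) (m := m)) (1 / (2 * m)) := by
  classical
  intro e he
  have hm' : (1 : ℝ) ≤ m := by exact_mod_cast hm
  let v : Cube d → ℝ := fun x => if h : ∃ j : Fin d → Fin m, gridPoint j = x then
    1 / 2 + 1 / (2 * m) * e h.choose else 0
  have hinj : Function.Injective (gridPoint (d := d) (m := m)) := fun j j' hj => by
    by_contra hne
    have := one_div_le_dist_gridPoint hne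
    rw [hj, dist_self] at this
    have : 0 < 1 / (m : ℝ) := by positivity
    linarith
  have hv : ∀ j, v (gridPoint j) = 1 / 2 + 1 / (2 * m) * e j := fun j => by
    have h : ∃ j' : Fin d → Fin m, gridPoint j' = gridPoint j := ⟨j, rfl⟩
    simp only [v, dif_pos h, hinj h.choose_spec]
  have hlip : LipschitzOnWith 1 v (Set.range (gridPoint (d := d) (m := m))) := by
    refine LipschitzOnWith.of_dist_le_mul ?_
    rintro _ ⟨j, rfl⟩ _ ⟨j', rfl⟩
    by_cases h : j = j'
    · simp [h]
    refine le_trans ?_ (le_of_le_of_eq (one_div_le_dist_gridPoint h) (by simp))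
    rw [hv, hv, Real.dist_eq, show 1 / 2 + 1 / (2 * (m : ℝ)) * e j - (1 / 2 + 1 / (2 * m) * e j')
      = 1 / (2 * m) * (e j - e j') by ring, abs_mul, abs_of_pos (by positivity)]
    have : |e j - e j'| ≤ 2 := (abs_sub _ _).trans (by rw [he, he]; norm_num)
    calc 1 / (2 * (m : ℝ)) * |e j - e j'| ≤ 1 / (2 * m) * 2 := by gcongr
      _ = 1 / m := by field_simp
  obtain ⟨g, hg, hvg⟩ := hlip.extend_real
  refine ⟨fun x => Set.projIcc 0 1 zero_le_one (g x), ?_, fun j => ?_⟩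
  · have := (LipschitzWith.projIcc (zero_le_one (α := ℝ))).comp hg
    rwa [one_mul] at this
  · have hj : g (gridPoint j) = 1 / 2 + 1 / (2 * m) * e j := by
      rw [← hv]
      exact (hvg ⟨j, rfl⟩).symm
    have h1 : |1 / (2 * (m : ℝ)) * e j| ≤ 1 / 2 := by
      rw [abs_mul, he, mul_one, abs_of_pos (by positivity)]
      gcongr
      linarith
    have h2 := abs_le.1 h1
    simp only [hj]
    rw [Set.projIcc_of_mem zero_le_one ⟨by linarith, by linarith⟩]

theorem lipschitzClass_nonempty (d : ℕ) : (lipschitzClass d).Nonempty :=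
  ⟨fun _ => 0, (LipschitzWith.const _).weaken zero_le_one⟩

theorem sqrt_le_hybridRegret_lipschitzClass (d : ℕ) {m T : ℕ} (hm : 1 ≤ m) (hT : m ^ d ≤ T)
    (Φ : PredictionRule (Cube d)) :
    √((m : ℝ) ^ d * T) / (4 * m) ≤ hybridRegret absLoss (lipschitzClass d) Φ T := by
  classical
  have hm' : (1 : ℝ) ≤ m := by exact_mod_cast hm
  have : NeZero m := ⟨by omega⟩
  have hinj : Function.Injective (gridPoint (d := d) (m := m)) := fun j j' hj => by
    by_contra hne
    have := one_div_le_dist_gridPoint hne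
    rw [hj, dist_self] at this
    have : 0 < 1 / (m : ℝ) := by positivity
    linarith
  have h := sqrt_le_hybridRegret (lipschitzClass_nonempty d) hinj (by positivity)
    (by gcongr; linarith) (shatters_gridPoint d hm) (T := T) (by simpa using hT) Φ
  refine le_of_eq_of_le ?_ h
  simp only [Fintype.card_pi, Fintype.card_fin, Finset.prod_const, Finset.card_univ]
  push_cast
  field_simp
  ring

/-! ## The growth of the number of scales -/

/-- The finest scale in use when `n` samples are known: the largest `k` with
`2 ^ (k * max d 2) ≤ n`. -/
def scale (d n : ℕ) : ℕ := Nat.log (2 ^ max d 2) n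

/-- The exponent of the minimax regret. -/
def rateExponent (d : ℕ) : ℝ := max (1 / 2 : ℝ) (((d : ℝ) - 1) / (d : ℝ))

theorem one_lt_two_pow_max (d : ℕ) : 1 < 2 ^ max d 2 :=
  Nat.one_lt_two_pow (by have := le_max_right d 2; omega)

theorem rateExponent_eq {d : ℕ} (hd : 1 ≤ d) :
    rateExponent d = 1 - 1 / ((max d 2 : ℕ) : ℝ) := by
  have hd' : (1 : ℝ) ≤ d := by exact_mod_cast hd
  rcases Nat.lt_or_ge d 2 with h | h
  · obtain rfl : d = 1 := by omega
    norm_num [rateExponent]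
  · have h' : (2 : ℝ) ≤ d := by exact_mod_cast h
    rw [rateExponent, max_eq_left h, max_eq_right]
    · field_simp
    · rw [le_div_iff₀ (by linarith)]
      linarith

theorem le_scale_iff {d n k : ℕ} (hn : n ≠ 0) : k ≤ scale d n ↔ (2 ^ max d 2) ^ k ≤ n :=
  Nat.le_log_iff_pow_le (one_lt_two_pow_max d) hn

theorem scale_mono (d : ℕ) : Monotone (scale d) := fun _ _ h => Nat.log_mono_right h

theorem two_pow_scale_le {d n : ℕ} (hn : n ≠ 0) :
    (2 : ℝ) ^ scale d n ≤ (n : ℝ) ^ (1 / ((max d 2 : ℕ) : ℝ)) := by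
  have h : (2 ^ max d 2) ^ scale d n ≤ n := (le_scale_iff hn).1 le_rfl
  have h' : ((2 : ℝ) ^ scale d n) ^ max d 2 ≤ n := by
    rw [← pow_mul, mul_comm, pow_mul]
    exact_mod_cast h
  have hD : max d 2 ≠ 0 := by have := le_max_right d 2; omega
  calc (2 : ℝ) ^ scale d n
      = (((2 : ℝ) ^ scale d n) ^ max d 2) ^ (1 / ((max d 2 : ℕ) : ℝ)) := by
        rw [one_div, Real.pow_rpow_inv_natCast (by positivity) hD]
    _ ≤ _ := Real.rpow_le_rpow (by positivity) h' (by positivity)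

theorem le_two_pow_scale {d n : ℕ} :
    (n : ℝ) ^ (1 / ((max d 2 : ℕ) : ℝ)) ≤ 2 * 2 ^ scale d n := by
  have h : n ≤ (2 ^ max d 2) ^ (scale d n + 1) :=
    (Nat.lt_pow_succ_log_self (one_lt_two_pow_max d) n).le
  have h' : (n : ℝ) ≤ ((2 : ℝ) ^ (scale d n + 1)) ^ max d 2 := by
    rw [← pow_mul, mul_comm, pow_mul]
    exact_mod_cast h
  have hD : max d 2 ≠ 0 := by have := le_max_right d 2; omega
  calc _ ≤ (((2 : ℝ) ^ (scale d n + 1)) ^ max d 2) ^ (1 / ((max d 2 : ℕ) : ℝ)) :=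
        Real.rpow_le_rpow (by positivity) h' (by positivity)
    _ = 2 * 2 ^ scale d n := by
        rw [one_div, Real.pow_rpow_inv_natCast (by positivity) hD, pow_succ, mul_comm]

theorem scale_le_log {d n : ℕ} (hn : n ≠ 0) : (scale d n : ℝ) ≤ Real.log n := by
  have h : (2 ^ max d 2) ^ scale d n ≤ n := (le_scale_iff hn).1 le_rfl
  have h4 : (4 : ℝ) ^ scale d n ≤ n := by
    have : 4 ^ scale d n ≤ (2 ^ max d 2) ^ scale d n :=
      Nat.pow_le_pow_left (by
        calc 4 = 2 ^ 2 := by norm_num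
          _ ≤ 2 ^ max d 2 := Nat.pow_le_pow_right (by norm_num) (le_max_right _ _)) _
    exact_mod_cast this.trans h
  have h5 := Real.log_le_log (by positivity) h4
  rw [Real.log_pow] at h5
  have h6 : 1 ≤ Real.log 4 := by
    rw [Real.le_log_iff_exp_le (by norm_num)]
    linarith [Real.exp_one_lt_d9]
  nlinarith [(Nat.cast_nonneg (scale d n) : (0 : ℝ) ≤ scale d n)]

/-- Induction on T; by Bernoulli's inequality for the exponent 1 - β, the increment of T^(1-β) /
(1-β) is at least the new summand. -/
theorem sum_rpow_neg_le {β : ℝ} (h0 : 0 ≤ β) (h1 : β < 1) (T : ℕ) :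
    ∑ t ∈ Finset.range T, ((t + 1 : ℕ) : ℝ) ^ (-β) ≤ (T : ℝ) ^ (1 - β) / (1 - β) := by
  have hb : 0 < 1 - β := by linarith
  induction T with
  | zero => simp [Real.zero_rpow hb.ne']
  | succ T ih =>
    rw [Finset.sum_range_succ]
    have hT : (0 : ℝ) < ((T + 1 : ℕ) : ℝ) := by positivity
    have hb' := rpow_one_add_le_one_add_mul_self (s := -(1 / ((T + 1 : ℕ) : ℝ))) (p := 1 - β)
      (by
        have : 1 / ((T + 1 : ℕ) : ℝ) ≤ 1 := (div_le_one hT).2 (by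
          push_cast
          linarith [(Nat.cast_nonneg T : (0 : ℝ) ≤ T)])
        linarith) hb.le (by linarith)
    have e : 1 + -(1 / ((T + 1 : ℕ) : ℝ)) = T / ((T + 1 : ℕ) : ℝ) := by
      push_cast
      have : (T : ℝ) + 1 ≠ 0 := by positivity
      field_simp
      ring
    rw [e, Real.div_rpow (by positivity) hT.le, div_le_iff₀ (by positivity)] at hb'
    have e2 : ((T + 1 : ℕ) : ℝ) ^ (-β) = ((T + 1 : ℕ) : ℝ) ^ (1 - β) / ((T + 1 : ℕ) : ℝ) := by
      rw [← Real.rpow_sub_one hT.ne']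
      congr 1
      ring
    calc _ ≤ (T : ℝ) ^ (1 - β) / (1 - β) + ((T + 1 : ℕ) : ℝ) ^ (1 - β) / ((T + 1 : ℕ) : ℝ) := by
          rw [e2]; gcongr
      _ ≤ (1 + (1 - β) * -(1 / ((T + 1 : ℕ) : ℝ))) * ((T + 1 : ℕ) : ℝ) ^ (1 - β) / (1 - β)
          + ((T + 1 : ℕ) : ℝ) ^ (1 - β) / ((T + 1 : ℕ) : ℝ) := by gcongr
      _ = _ := by field_simp; ring

/-- One factor 2 comes from rounding the mesh to a power of 2, the other from 1/(1-β) ≤ 2, as β =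
1/D ≤ 1/2. -/
theorem sum_inv_two_pow_scale_le {d : ℕ} (hd : 1 ≤ d) (T : ℕ) :
    ∑ t ∈ Finset.range T, 1 / (2 : ℝ) ^ scale d (t + 1) ≤ 4 * (T : ℝ) ^ rateExponent d := by
  have hD : (2 : ℝ) ≤ ((max d 2 : ℕ) : ℝ) := by exact_mod_cast le_max_right d 2
  have hβ : 1 / ((max d 2 : ℕ) : ℝ) ≤ 1 / 2 := by gcongr
  have h := sum_rpow_neg_le (β := 1 / ((max d 2 : ℕ) : ℝ)) (by positivity) (by linarith) T
  rw [rateExponent_eq hd]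
  calc _ ≤ ∑ t ∈ Finset.range T, 2 * ((t + 1 : ℕ) : ℝ) ^ (-(1 / ((max d 2 : ℕ) : ℝ))) := by
        refine Finset.sum_le_sum fun t _ => ?_
        rw [Real.rpow_neg (by positivity), ← div_eq_mul_inv, div_le_div_iff₀ (by positivity)
          (by positivity), one_mul]
        exact le_two_pow_scale
    _ ≤ 2 * ((T : ℝ) ^ (1 - 1 / ((max d 2 : ℕ) : ℝ)) / (1 - 1 / ((max d 2 : ℕ) : ℝ))) := by
        rw [← Finset.mul_sum]
        gcongr
    _ ≤ 2 * ((T : ℝ) ^ (1 - 1 / ((max d 2 : ℕ) : ℝ)) / (1 / 2)) := by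
        gcongr
        linarith
    _ = _ := by ring

theorem two_pow_scale_pow_le {d : ℕ} (hd : 1 ≤ d) {T : ℕ} (hT : 1 ≤ T) :
    ((2 : ℝ) ^ scale d (T + 1)) ^ (max d 2 - 1) ≤ 2 * (T : ℝ) ^ rateExponent d := by
  have hD2 := le_max_right d 2
  have hD : (2 : ℝ) ≤ ((max d 2 : ℕ) : ℝ) := by exact_mod_cast hD2
  have hT' : (1 : ℝ) ≤ T := by exact_mod_cast hT
  have hα : rateExponent d ≤ 1 := by
    rw [rateExponent_eq hd]
    have : 0 ≤ 1 / ((max d 2 : ℕ) : ℝ) := by positivity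
    linarith
  have hα0 : 0 ≤ rateExponent d := le_trans (by norm_num) (le_max_left _ _)
  calc _ ≤ (((T + 1 : ℕ) : ℝ) ^ (1 / ((max d 2 : ℕ) : ℝ))) ^ (max d 2 - 1) := by
        gcongr
        exact two_pow_scale_le (by omega)
    _ = ((T + 1 : ℕ) : ℝ) ^ rateExponent d := by
        rw [← Real.rpow_natCast, ← Real.rpow_mul (by positivity), rateExponent_eq hd]
        congr 1
        rw [Nat.cast_sub (by omega)]
        field_simp
        simp
    _ ≤ (2 * (T : ℝ)) ^ rateExponent d := by
        gcongr
        push_cast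
        linarith
    _ = 2 ^ rateExponent d * (T : ℝ) ^ rateExponent d := Real.mul_rpow (by norm_num) (by linarith)
    _ ≤ 2 ^ (1 : ℝ) * (T : ℝ) ^ rateExponent d := by
        gcongr
        norm_num
    _ = _ := by rw [Real.rpow_one]

theorem rpow_le_hybridRegret {d : ℕ} (hd : 1 ≤ d) {T : ℕ} (hT : 1 ≤ T)
    (Φ : PredictionRule (Cube d)) :
    (T : ℝ) ^ rateExponent d / (4 * 2 ^ d) ≤
      hybridRegret absLoss (lipschitzClass d) Φ T := by
  have hT' : (1 : ℝ) ≤ T := by exact_mod_cast hT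
  rcases Nat.lt_or_ge d 2 with h | h
  · obtain rfl : d = 1 := by omega
    have h1 := sqrt_le_hybridRegret_lipschitzClass 1 le_rfl (by simpa using hT) Φ
    refine le_trans ?_ h1
    have e : rateExponent 1 = 1 / 2 := by norm_num [rateExponent]
    rw [e, ← Real.sqrt_eq_rpow]
    norm_num
    have := Real.sqrt_nonneg (T : ℝ)
    linarith
  -- The grid size is m = 2 ^ `scale d T`, which is T^(1/d) up to a factor 2; then √(mᵈ T) / m has
  -- order T^(1-1/d).
  · have hle : (2 ^ scale d T) ^ d ≤ T := by
      have := (le_scale_iff (d := d) (n := T) (by omega)).1 le_rfl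
      rwa [max_eq_left h, ← pow_mul, mul_comm, pow_mul] at this
    refine le_trans ?_ (sqrt_le_hybridRegret_lipschitzClass d Nat.one_le_two_pow hle Φ)
    push_cast
    set m : ℝ := 2 ^ scale d T
    have hm : 0 < m := by positivity
    have hlow : (T : ℝ) ^ (1 / (d : ℝ)) ≤ 2 * m := by
      have := le_two_pow_scale (d := d) (n := T)
      rwa [max_eq_left h] at this
    have hup : m ≤ (T : ℝ) ^ (1 / (d : ℝ)) := by
      have := two_pow_scale_le (d := d) (n := T) (by omega)
      rwa [max_eq_left h] at this
    have hTd : (T : ℝ) ≤ 2 ^ d * m ^ d := by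
      calc (T : ℝ) = ((T : ℝ) ^ (1 / (d : ℝ))) ^ d := by
            rw [one_div, Real.rpow_inv_natCast_pow (by positivity) (by omega)]
        _ ≤ (2 * m) ^ d := by gcongr
        _ = _ := mul_pow _ _ _
    have hs : (T : ℝ) / 2 ^ d ≤ √(m ^ d * T) := by
      refine Real.le_sqrt_of_sq_le ?_
      rw [div_pow, div_le_iff₀ (by positivity)]
      have h1 : (1 : ℝ) ≤ 2 ^ d := one_le_pow₀ (by norm_num)
      calc (T : ℝ) ^ 2 = T * T := sq _
        _ ≤ (2 ^ d * m ^ d) * T := by gcongr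
        _ ≤ (2 ^ d * m ^ d) * T * 2 ^ d := le_mul_of_one_le_right (by positivity) h1
        _ = _ := by ring
    have hα : rateExponent d = 1 - 1 / (d : ℝ) := by rw [rateExponent_eq hd, max_eq_left h]
    rw [hα, Real.rpow_sub (by linarith), Real.rpow_one]
    calc (T : ℝ) / (T : ℝ) ^ (1 / (d : ℝ)) / (4 * 2 ^ d) ≤ T / m / (4 * 2 ^ d) := by gcongr
      _ = (T / 2 ^ d) / (4 * m) := by field_simp
      _ ≤ _ := by gcongr

/-! ## The multiscale predictor -/

section Predictor

variable {d : ℕ}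

/-- The dyadic cell of side `2⁻ᵏ` containing `x`. -/
def cell (k : ℕ) (x : Cube d) : Fin d → ℕ := fun i => ⌊2 ^ k * (x i : ℝ)⌋₊

/-- The number of scales, among those in use at time `s`, at which `x` and `x'` share a cell. -/
def matchCount (s : ℕ) (x x' : Cube d) : ℕ :=
  ((Finset.range (scale d (s + 1) + 1)).filter fun k => cell k x = cell k x').card

/-- The sign of the correction made at time `t`: `-1` if the score is at least the label, and `1`
otherwise. -/
def correction (x : ℕ → Cube d) (y : ℕ → ℝ) (t : ℕ) : ℝ :=
  if y t ≤ (∑ s : Fin t, correction x y s * matchCount s (x s) (x t)) / 2 ^ scale d (t + 1)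
  then -1 else 1
decreasing_by exact s.2

/-- The prediction at time `t` before it is truncated to `[0,1]`. -/
def score (x : ℕ → Cube d) (y : ℕ → ℝ) (t : ℕ) : ℝ :=
  (∑ s ∈ Finset.range t, correction x y s * matchCount s (x s) (x t)) / 2 ^ scale d (t + 1)

theorem correction_eq (x : ℕ → Cube d) (y : ℕ → ℝ) (t : ℕ) :
    correction x y t = if y t ≤ score x y t then -1 else 1 := by
  rw [correction, score, Finset.sum_range]

theorem correction_sq (x : ℕ → Cube d) (y : ℕ → ℝ) (t : ℕ) : correction x y t ^ 2 = 1 := by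
  rw [correction_eq]
  split_ifs <;> norm_num

theorem correction_congr {x x' : ℕ → Cube d} {y y' : ℕ → ℝ} (t : ℕ) (hx : ∀ i ≤ t, x i = x' i)
    (hy : ∀ i ≤ t, y i = y' i) : correction x y t = correction x' y' t := by
  induction t using Nat.strong_induction_on with
  | _ t ih =>
    rw [correction_eq, correction_eq, score, score, hx t le_rfl, hy t le_rfl,
      Finset.sum_congr rfl fun s hs => ?_]
    rw [Finset.mem_range] at hs
    rw [ih s hs (fun i hi => hx i (hi.trans hs.le)) (fun i hi => hy i (hi.trans hs.le)),
      hx s hs.le]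

theorem score_congr {x x' : ℕ → Cube d} {y y' : ℕ → ℝ} (t : ℕ) (hx : ∀ i ≤ t, x i = x' i)
    (hy : ∀ i < t, y i = y' i) : score x y t = score x' y' t := by
  rw [score, score, hx t le_rfl, Finset.sum_congr rfl fun s hs => ?_]
  rw [Finset.mem_range] at hs
  rw [correction_congr s (fun i hi => hx i (hi.trans hs.le)) (fun i hi => hy i (hi.trans_lt hs)),
    hx s hs.le]

/-- The regret of follow the regularized leader in dimension one, with the quadratic
regularizer. -/
theorem ftrl_regret_le {η : ℕ → ℝ} (hη : Antitone η) (hpos : ∀ t, 0 < η t) (v : ℕ → ℝ) (u : ℝ)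
    (T : ℕ) :
    u * ∑ t ∈ Finset.range T, v t
      - ∑ t ∈ Finset.range T, η t * (v t * ∑ s ∈ Finset.range t, v s) ≤
      u ^ 2 / (2 * η T) + (∑ t ∈ Finset.range T, η t * v t ^ 2) / 2 := by
  -- The potential η_T V² / 2, with V the sum of the v_t, grows by at most η_T (v V + v²/2) per step
  -- because η decreases. The comparator then enters by completing the square.
  have key : η T / 2 * (∑ t ∈ Finset.range T, v t) ^ 2
      - ∑ t ∈ Finset.range T, η t * (v t * ∑ s ∈ Finset.range t, v s) ≤
      (∑ t ∈ Finset.range T, η t * v t ^ 2) / 2 := by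
    induction T with
    | zero => simp
    | succ T ih =>
      simp only [Finset.sum_range_succ]
      have h1 := hη (Nat.le_succ T)
      have h2 := mul_le_mul_of_nonneg_right h1 (sq_nonneg (∑ t ∈ Finset.range T, v t + v T))
      simp only [Nat.succ_eq_add_one] at h2
      nlinarith
  have h : 0 ≤ (u - η T * ∑ t ∈ Finset.range T, v t) ^ 2 / (2 * η T) :=
    div_nonneg (sq_nonneg _) (by linarith [hpos T])
  have e : (u - η T * ∑ t ∈ Finset.range T, v t) ^ 2 / (2 * η T) = u ^ 2 / (2 * η T)
      - u * ∑ t ∈ Finset.range T, v t + η T / 2 * (∑ t ∈ Finset.range T, v t) ^ 2 := by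
    have := (hpos T).ne'
    field_simp
    ring
  linarith

/-- The value of `h` at the point of the cube nearest to `a`. -/
def evalClamped (h : Cube d → I) (a : Fin d → ℝ) : ℝ :=
  h fun i => Set.projIcc 0 1 zero_le_one (a i)

theorem abs_evalClamped_sub_le {h : Cube d → I} (hh : LipschitzWith 1 h) {a b : Fin d → ℝ} {ε : ℝ}
    (hε : 0 ≤ ε) (hab : ∀ i, |a i - b i| ≤ ε) :
    |evalClamped h a - evalClamped h b| ≤ ε := by
  have h1 := hh.dist_le_mul (fun i => Set.projIcc 0 1 zero_le_one (a i))
    (fun i => Set.projIcc 0 1 zero_le_one (b i))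
  rw [Subtype.dist_eq, Real.dist_eq, NNReal.coe_one, one_mul] at h1
  refine h1.trans ((dist_pi_le_iff hε).2 fun i => ?_)
  have h2 := (LipschitzWith.projIcc (zero_le_one (α := ℝ))).dist_le_mul (a i) (b i)
  rw [Real.dist_eq, NNReal.coe_one, one_mul] at h2
  exact h2.trans (hab i)

theorem evalClamped_mem (h : Cube d → I) (a : Fin d → ℝ) : |evalClamped h a| ≤ 1 := by
  rw [evalClamped, abs_of_nonneg (h _).2.1]
  exact (h _).2.2

/-- The value of `h` at the corner of a cell of scale `k`, minus the value at the corner of its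
parent. -/
def increment (h : Cube d → I) : ℕ → (Fin d → ℕ) → ℝ
  | 0, j => evalClamped h fun i => j i
  | k + 1, j => evalClamped h (fun i => j i / 2 ^ (k + 1))
      - evalClamped h fun i => ((j i / 2 : ℕ) : ℝ) / 2 ^ k

/-- The corner of a cell is within one unit 2⁻ᵏ of its parent's corner. Clamping the arguments of
`h` allows arbitrary indices `j`, also outside the cube. -/
theorem abs_increment_le {h : Cube d → I} (hh : LipschitzWith 1 h) (k : ℕ) (j : Fin d → ℕ) :
    |increment h k j| ≤ 1 / 2 ^ k := by
  cases k with
  | zero => simpa [increment] using evalClamped_mem h _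
  | succ k =>
    refine abs_evalClamped_sub_le hh (by positivity) fun i => ?_
    have e : (j i : ℝ) / 2 ^ (k + 1) - ((j i / 2 : ℕ) : ℝ) / 2 ^ k =
        ((j i % 2 : ℕ) : ℝ) / 2 ^ (k + 1) := by
      have : (j i : ℝ) = 2 * ((j i / 2 : ℕ) : ℝ) + ((j i % 2 : ℕ) : ℝ) := by
        exact_mod_cast (Nat.div_add_mod _ _).symm
      rw [this, pow_succ]
      field_simp
      ring
    rw [e, abs_of_nonneg (by positivity)]
    gcongr
    have : j i % 2 ≤ 1 := by omega
    exact_mod_cast this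

theorem cell_succ_div_two (k : ℕ) (x : Cube d) (i : Fin d) : cell (k + 1) x i / 2 = cell k x i := by
  rw [cell, cell, ← Nat.floor_div_ofNat, pow_succ]
  congr 1
  ring

theorem sum_increment (h : Cube d → I) (x : Cube d) (k : ℕ) :
    ∑ k ∈ Finset.range (k + 1), increment h k (cell k x) =
      evalClamped h fun i => cell k x i / 2 ^ k := by
  induction k with
  | zero => simp [increment]
  | succ k ih =>
    rw [Finset.sum_range_succ, ih, increment]
    simp only [cell_succ_div_two]
    ring

/-- The increments telescope to the value of `h` at the corner of the cell of `x`, which is within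
2⁻ᵏ of `x`. -/
theorem abs_sum_increment_sub_le {h : Cube d → I} (hh : LipschitzWith 1 h) (x : Cube d) (k : ℕ) :
    |∑ k ∈ Finset.range (k + 1), increment h k (cell k x) - h x| ≤ 1 / 2 ^ k := by
  have e : (h x : ℝ) = evalClamped h fun i => x i := by simp [evalClamped]
  rw [sum_increment, e]
  refine abs_evalClamped_sub_le hh (by positivity) fun i => ?_
  have h0 : 0 ≤ (2 : ℝ) ^ k * x i := mul_nonneg (by positivity) (x i).2.1
  have h1 := Nat.floor_le h0
  have h2 := Nat.lt_floor_add_one ((2 : ℝ) ^ k * x i)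
  have e : (cell k x i : ℝ) / 2 ^ k - x i = (⌊(2 : ℝ) ^ k * x i⌋₊ - 2 ^ k * x i) / 2 ^ k := by
    rw [cell]
    field_simp
  rw [e, abs_div, abs_of_pos (by positivity : (0 : ℝ) < 2 ^ k)]
  gcongr
  rw [abs_le]
  constructor <;> linarith

/-- All cells of scale `k`. -/
def cells (d k : ℕ) : Finset (Fin d → ℕ) := Fintype.piFinset fun _ => Finset.range (2 ^ k + 1)

/-- A coordinate equal to 1 has index 2ᵏ, which is why `cells` has 2ᵏ + 1 indices in each direction.
-/
theorem cell_mem_cells (k : ℕ) (x : Cube d) : cell k x ∈ cells d k := by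
  rw [cells, Fintype.mem_piFinset]
  intro i
  rw [Finset.mem_range, Nat.lt_succ_iff]
  refine Nat.floor_le_of_le ?_
  push_cast
  exact mul_le_of_le_one_right (by positivity) (x i).2.2

theorem card_cells_le (d k : ℕ) : ((cells d k).card : ℝ) ≤ 2 ^ d * (2 ^ k) ^ d := by
  rw [cells, Fintype.card_piFinset]
  simp only [Finset.card_range, Finset.prod_const, Finset.card_univ, Fintype.card_fin]
  push_cast
  rw [← mul_pow]
  gcongr
  have : (1 : ℝ) ≤ 2 ^ k := one_le_pow₀ (by norm_num)
  linarith

/-- The correction at time `t` as seen from the cell `j` of scale `k`. -/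
def cellCorrection (x : ℕ → Cube d) (y : ℕ → ℝ) (k : ℕ) (j : Fin d → ℕ) (t : ℕ) : ℝ :=
  if k ≤ scale d (t + 1) ∧ cell k (x t) = j then correction x y t else 0

/-- At each scale exactly one cell contains the current point, so only its term survives. -/
theorem sum_cells_cellCorrection_mul (x : ℕ → Cube d) (y : ℕ → ℝ) (k t : ℕ)
    (f : (Fin d → ℕ) → ℝ) :
    ∑ j ∈ cells d k, cellCorrection x y k j t * f j =
      if k ≤ scale d (t + 1) then correction x y t * f (cell k (x t)) else 0 := by
  rw [Finset.sum_eq_single (cell k (x t))]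
  · simp [cellCorrection]
  · intro j _ hj
    simp [cellCorrection, hj.symm]
  · exact fun h => absurd (cell_mem_cells k (x t)) h

theorem sum_range_ite_le {a b : ℕ} (h : a ≤ b) (f : ℕ → ℝ) :
    (∑ k ∈ Finset.range (b + 1), if k ≤ a then f k else 0) = ∑ k ∈ Finset.range (a + 1), f k := by
  rw [← Finset.sum_filter]
  congr 1
  ext k
  simp only [Finset.mem_filter, Finset.mem_range]
  omega

theorem sum_cellCorrection_mul_increment (x : ℕ → Cube d) (y : ℕ → ℝ) (h : Cube d → I) {t T : ℕ}
    (ht : t < T) :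
    ∑ k ∈ Finset.range (scale d T + 1), ∑ j ∈ cells d k,
      cellCorrection x y k j t * increment h k j =
      correction x y t *
        ∑ k ∈ Finset.range (scale d (t + 1) + 1), increment h k (cell k (x t)) := by
  simp only [sum_cells_cellCorrection_mul]
  rw [sum_range_ite_le (scale_mono d ht) fun k =>
    correction x y t * increment h k (cell k (x t)), Finset.mul_sum]

/-- This identifies the combined predictions of all cell learners with the score. The earlier point
`s` has fed only the scales in use at its own time, hence the range in `matchCount`. -/
theorem sum_cellCorrection_mul_sum (x : ℕ → Cube d) (y : ℕ → ℝ) {t T : ℕ} (ht : t < T) :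
    ∑ k ∈ Finset.range (scale d T + 1), ∑ j ∈ cells d k,
      cellCorrection x y k j t * ∑ s ∈ Finset.range t, cellCorrection x y k j s =
      correction x y t * ∑ s ∈ Finset.range t, correction x y s * matchCount s (x s) (x t) := by
  simp only [sum_cells_cellCorrection_mul]
  rw [sum_range_ite_le (scale_mono d ht) fun k =>
    correction x y t * ∑ s ∈ Finset.range t, cellCorrection x y k (cell k (x t)) s,
    ← Finset.mul_sum, Finset.sum_comm]
  congr 1
  refine Finset.sum_congr rfl fun s hs => ?_
  rw [Finset.mem_range] at hs
  have e : ∀ k, cellCorrection x y k (cell k (x t)) s = if k ≤ scale d (s + 1) then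
      (if cell k (x s) = cell k (x t) then correction x y s else 0) else 0 := fun k => by
    rw [cellCorrection, ite_and]
  simp only [e]
  rw [sum_range_ite_le (scale_mono d (by omega)), ← Finset.sum_filter, Finset.sum_const,
    nsmul_eq_mul, mul_comm, matchCount]

/-- The regret of the multiscale predictor, after linearization. -/
theorem linear_regret_le (x : ℕ → Cube d) (y : ℕ → ℝ) {h : Cube d → I} (hh : LipschitzWith 1 h)
    (T : ℕ) :
    ∑ t ∈ Finset.range T, correction x y t *
      (∑ k ∈ Finset.range (scale d (t + 1) + 1), increment h k (cell k (x t)) - score x y t) ≤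
      (scale d T + 1) * (2 ^ d * (2 ^ scale d (T + 1)) ^ (max d 2 - 1) / 2
        + (∑ t ∈ Finset.range T, 1 / (2 : ℝ) ^ scale d (t + 1)) / 2) := by
  set η : ℕ → ℝ := fun t => 1 / (2 : ℝ) ^ scale d (t + 1) with hη
  have hηpos : ∀ t, 0 < η t := fun t => by positivity
  have hηanti : Antitone η := fun s t hst => by
    refine one_div_le_one_div_of_le (by positivity) (pow_le_pow_right₀ (by norm_num) ?_)
    exact scale_mono d (by omega)
  have h1 : ∀ k j, _ := fun k j =>
    ftrl_regret_le hηanti hηpos (cellCorrection x y k j) (increment h k j) T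
  -- The linearized regret splits into the separate regrets of the cell learners, the comparator of
  -- each being the increment of `h` on its cell.
  have h2 : ∑ t ∈ Finset.range T, correction x y t *
      (∑ k ∈ Finset.range (scale d (t + 1) + 1), increment h k (cell k (x t)) - score x y t) =
      ∑ k ∈ Finset.range (scale d T + 1), ∑ j ∈ cells d k,
        (increment h k j * ∑ t ∈ Finset.range T, cellCorrection x y k j t
        - ∑ t ∈ Finset.range T, η t * (cellCorrection x y k j t *
          ∑ s ∈ Finset.range t, cellCorrection x y k j s)) := by
    have e : ∀ k j, (increment h k j * ∑ t ∈ Finset.range T, cellCorrection x y k j t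
        - ∑ t ∈ Finset.range T, η t * (cellCorrection x y k j t *
          ∑ s ∈ Finset.range t, cellCorrection x y k j s)) =
        ∑ t ∈ Finset.range T, (cellCorrection x y k j t * increment h k j
          - η t * (cellCorrection x y k j t *
          ∑ s ∈ Finset.range t, cellCorrection x y k j s)) := fun k j => by
      rw [Finset.sum_sub_distrib, Finset.mul_sum]
      simp only [mul_comm (increment h k j)]
    simp only [e]
    simp only [Finset.sum_comm (t := Finset.range T)]
    refine Finset.sum_congr rfl fun t ht => ?_
    rw [Finset.mem_range] at ht
    simp only [Finset.sum_sub_distrib]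
    rw [sum_cellCorrection_mul_increment x y h ht]
    simp only [← Finset.mul_sum]
    rw [sum_cellCorrection_mul_sum x y ht, score, hη]
    ring
  rw [h2]
  -- At a fixed scale the comparator terms are bounded by the number of cells, while the gradient
  -- terms add up to at most ∑ η_t, since each time feeds at most one cell.
  have h3 : ∀ k ∈ Finset.range (scale d T + 1), ∑ j ∈ cells d k,
      (increment h k j * ∑ t ∈ Finset.range T, cellCorrection x y k j t
        - ∑ t ∈ Finset.range T, η t * (cellCorrection x y k j t *
          ∑ s ∈ Finset.range t, cellCorrection x y k j s)) ≤
      2 ^ d * (2 ^ scale d (T + 1)) ^ (max d 2 - 1) / 2 + (∑ t ∈ Finset.range T, η t) / 2 := by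
    intro k hk
    rw [Finset.mem_range] at hk
    refine (Finset.sum_le_sum fun j _ => h1 k j).trans ?_
    rw [Finset.sum_add_distrib]
    refine add_le_add ?_ ?_
    · have hj : ∀ j ∈ cells d k, increment h k j ^ 2 / (2 * η T) ≤
          (1 / 2 ^ k) ^ 2 * 2 ^ scale d (T + 1) / 2 := fun j _ => by
        have := sq_le_sq' (abs_le.1 (abs_increment_le hh k j)).1
          (abs_le.1 (abs_increment_le hh k j)).2
        rw [hη, div_le_iff₀ (by positivity)]
        refine this.trans (le_of_eq ?_)
        field_simp
      refine (Finset.sum_le_card_nsmul _ _ _ hj).trans ?_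
      rw [nsmul_eq_mul]
      have hkK : k ≤ scale d (T + 1) :=
        (Nat.lt_succ_iff.1 hk).trans (scale_mono d (Nat.le_succ T))
      have hD := le_max_right d 2
      calc ((cells d k).card : ℝ) * ((1 / 2 ^ k) ^ 2 * 2 ^ scale d (T + 1) / 2)
          ≤ (2 ^ d * (2 ^ k) ^ d) * ((1 / 2 ^ k) ^ 2 * 2 ^ scale d (T + 1) / 2) := by
            gcongr
            exact card_cells_le d k
        -- Replacing d by D makes the power of 2ᵏ left after division by (2ᵏ)² nonnegative, so it is
        -- largest at the finest scale.
        _ ≤ (2 ^ d * (2 ^ k) ^ max d 2) * ((1 / 2 ^ k) ^ 2 * 2 ^ scale d (T + 1) / 2) := by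
            gcongr
            · exact one_le_pow₀ (by norm_num)
            · exact le_max_left _ _
        _ = 2 ^ d * (2 ^ k) ^ (max d 2 - 2) * 2 ^ scale d (T + 1) / 2 := by
            obtain ⟨e, he⟩ := Nat.exists_eq_add_of_le hD
            rw [he, Nat.add_sub_cancel_left, pow_add]
            field_simp
        _ ≤ 2 ^ d * (2 ^ scale d (T + 1)) ^ (max d 2 - 2) * 2 ^ scale d (T + 1) / 2 := by
            gcongr
            norm_num
        _ = _ := by
            rw [mul_assoc, ← pow_succ]
            congr 4
            omega
    · rw [← Finset.sum_div]
      gcongr ?_ / 2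
      rw [Finset.sum_comm]
      refine Finset.sum_le_sum fun t _ => ?_
      rw [← Finset.mul_sum]
      refine mul_le_of_le_one_right (hηpos t).le ?_
      have := sum_cells_cellCorrection_mul x y k t fun j => cellCorrection x y k j t
      simp only [← sq] at this
      rw [this, cellCorrection]
      simp only [and_true]
      split_ifs
      · rw [← sq, correction_sq]
      · norm_num
  refine (Finset.sum_le_card_nsmul _ _ _ h3).trans (le_of_eq ?_)
  rw [Finset.card_range, nsmul_eq_mul]
  push_cast
  ring

/-- Truncation cannot increase the loss since labels lie in [0,1], and the correction is a negative
subgradient of p ↦ |p - y| at the score. -/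
theorem absLoss_sub_le (x : ℕ → Cube d) (y : ℕ → I) (t : ℕ) (v : I) :
    absLoss (Set.projIcc 0 1 zero_le_one (score x (fun i => y i) t)) (y t) - absLoss v (y t) ≤
      correction x (fun i => y i) t * (v - score x (fun i => y i) t) := by
  set p := score x (fun i => (y i : ℝ)) t with hp
  have h1 : absLoss (Set.projIcc 0 1 zero_le_one p) (y t) ≤ |p - y t| := by
    have := (LipschitzWith.projIcc (zero_le_one (α := ℝ))).dist_le_mul p (y t)
    rwa [Set.projIcc_val, Subtype.dist_eq, Real.dist_eq, Real.dist_eq, NNReal.coe_one,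
      one_mul] at this
  rw [correction_eq, ← hp]
  have h2 : absLoss v (y t) = |(v : ℝ) - y t| := rfl
  split_ifs with h
  · rw [abs_of_nonneg (by linarith)] at h1
    linarith [le_abs_self ((v : ℝ) - y t)]
  · rw [abs_of_neg (by linarith)] at h1
    linarith [neg_abs_le ((v : ℝ) - y t)]

/-- The predictor as a function of the past samples and the current point. -/
def multiscale (past : List (Cube d × I)) (x : Cube d) : I :=
  Set.projIcc 0 1 zero_le_one (score (fun i => (past.map Prod.fst ++ [x]).getD i 0)
    (fun i => ((past.map Prod.snd).getD i 0 : I)) past.length)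

theorem multiscale_samples (x : ℕ → Cube d) (y : ℕ → I) (t : ℕ) :
    multiscale (samples x y t) (x t) =
      Set.projIcc 0 1 zero_le_one (score x (fun i => y i) t) := by
  rw [multiscale]
  congr 1
  have hl : (samples x y t).length = t := by simp [samples]
  rw [hl]
  have e : (samples x y t).map Prod.fst ++ [x t] = (List.range (t + 1)).map x := by
    simp [samples, List.range_succ, Function.comp_def]
  rw [e]
  refine score_congr t (fun i hi => ?_) fun i hi => ?_
  · simp [List.getD_eq_getElem?_getD, Nat.lt_succ_iff.2 hi]
  · simp [samples, List.getD_eq_getElem?_getD, hi]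

theorem realizedRegret_multiscale_le (hd : 1 ≤ d) {T : ℕ} (hT : 1 ≤ T) (x : ℕ → Cube d)
    (y : ℕ → I) :
    realizedRegret absLoss (lipschitzClass d) (roundsOf multiscale x y T) ≤
      (2 ^ d + 6) * (T : ℝ) ^ rateExponent d * (1 + Real.log T) := by
  have hne := lipschitzClass_nonempty d
  have : Nonempty (lipschitzClass d) := hne.to_subtype
  rw [realizedRegret, sub_le_comm]
  refine le_ciInf fun h => ?_
  have hh : LipschitzWith 1 h.1 := h.2
  rw [sub_le_comm]
  have list_sum : ∀ f : Cube d × I × I → ℝ, ((roundsOf multiscale x y T).map f).sum =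
      ∑ t ∈ Finset.range T, f (x t, y t, multiscale (samples x y t) (x t)) := fun f => by
    rw [roundsOf, List.map_map, ← List.sum_toFinset _ List.nodup_range, List.toFinset_range]
    rfl
  rw [list_sum, list_sum, ← Finset.sum_sub_distrib]
  simp only [multiscale_samples]
  have hlin := linear_regret_le x (fun i => (y i : ℝ)) hh T
  have hS := sum_inv_two_pow_scale_le hd T
  have hP := two_pow_scale_pow_le hd hT
  set A := (T : ℝ) ^ rateExponent d
  have hA : 0 ≤ A := by positivity
  have hlog : (scale d T : ℝ) ≤ Real.log T := scale_le_log (by omega)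
  have hlog0 : 0 ≤ Real.log T := Real.log_nonneg (by exact_mod_cast hT)
  calc ∑ t ∈ Finset.range T, (absLoss (Set.projIcc 0 1 zero_le_one
          (score x (fun i => (y i : ℝ)) t)) (y t) - absLoss (h.1 (x t)) (y t))
      ≤ ∑ t ∈ Finset.range T, (correction x (fun i => (y i : ℝ)) t *
        (∑ k ∈ Finset.range (scale d (t + 1) + 1), increment h.1 k (cell k (x t))
          - score x (fun i => (y i : ℝ)) t) + 1 / (2 : ℝ) ^ scale d (t + 1)) := by
        refine Finset.sum_le_sum fun t _ => ?_
        refine (absLoss_sub_le x y t (h.1 (x t))).trans ?_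
        have h1 := abs_sum_increment_sub_le hh (x t) (scale d (t + 1))
        set s := ∑ k ∈ Finset.range (scale d (t + 1) + 1), increment h.1 k (cell k (x t))
        have h2 : |correction x (fun i => (y i : ℝ)) t * (h.1 (x t) - s)| ≤
            1 / (2 : ℝ) ^ scale d (t + 1) := by
          rw [abs_mul, ← Real.sqrt_sq_eq_abs, correction_sq, Real.sqrt_one, one_mul, abs_sub_comm]
          exact h1
        linarith [(abs_le.1 h2).2]
    _ ≤ (scale d T + 1) * (2 ^ d * (2 ^ scale d (T + 1)) ^ (max d 2 - 1) / 2
        + (∑ t ∈ Finset.range T, 1 / (2 : ℝ) ^ scale d (t + 1)) / 2)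
        + ∑ t ∈ Finset.range T, 1 / (2 : ℝ) ^ scale d (t + 1) := by
        rw [Finset.sum_add_distrib]
        gcongr
    -- The constant 2ᵈ + 6 collects 2ᵈ from the comparator terms, 2 from the gradient terms and 4
    -- from the discretization error.
    _ ≤ (Real.log T + 1) * (2 ^ d * (2 * A) / 2 + 4 * A / 2) + 4 * A := by gcongr
    _ ≤ (Real.log T + 1) * (2 ^ d * (2 * A) / 2 + 4 * A / 2) + (Real.log T + 1) * (4 * A) := by
        nlinarith [mul_nonneg hlog0 hA]
    _ = _ := by ring

end Predictor

/-! ## Timed correctness of programs -/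

namespace MachineState

@[simp] theorem natMem_setNat (s : MachineState) (i v j : ℕ) :
    (s.setNat i v).natMem j = if j = i then v else s.natMem j := by
  simp [setNat, Function.update_apply]

@[simp] theorem realMem_setNat (s : MachineState) (i v : ℕ) :
    (s.setNat i v).realMem = s.realMem := rfl

@[simp] theorem natMem_setReal (s : MachineState) (i : ℕ) (v : ℝ) :
    (s.setReal i v).natMem = s.natMem := rfl

@[simp] theorem realMem_setReal (s : MachineState) (i : ℕ) (v : ℝ) (a : ℕ) :
    (s.setReal i v).realMem a = if a = s.natMem i then v else s.realMem a := by
  simp [setReal, Function.update_apply]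

end MachineState

/-- A sequence of instructions. -/
def Program.block : List Instr → Program
  | [] => .skip
  | a :: l => .seq (.instr a) (block l)

/-- The `n`-fold repetition of a program. -/
def Program.rep (P : Program) : ℕ → Program
  | 0 => .skip
  | n + 1 => .seq (rep P n) P

/-- An instruction other than an oracle call. -/
def Instr.IsBasic : Instr → Prop
  | oracle _ _ _ _ _ _ => False
  | _ => True

theorem Instr.IsBasic.cost_eq {a : Instr} (ha : a.IsBasic) (s : MachineState) : a.cost s = 1 := by
  cases a <;> first | rfl | exact ha.elim

section Runs

variable {d : ℕ} (loss : I → I → ℝ) (H : Set (Cube d → I))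

/-- Started in `s`, the program `P` halts within time `c` in a state that satisfies `Q`. -/
def Runs (P : Program) (s : MachineState) (c : ℕ) (Q : MachineState → Prop) : Prop :=
  ∃ τ s', Exec loss H P s τ s' ∧ τ ≤ c ∧ Q s'

variable {loss H} {P R : Program} {s : MachineState} {c c' : ℕ} {Q Q' : MachineState → Prop}

theorem Runs.mono (h : Runs loss H P s c Q) (hc : c ≤ c') (hQ : ∀ s', Q s' → Q' s') :
    Runs loss H P s c' Q' := by
  obtain ⟨τ, s', he, hτ, hq⟩ := h
  exact ⟨τ, s', he, hτ.trans hc, hQ s' hq⟩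

theorem Runs.skip (h : Q s) : Runs loss H .skip s 1 Q := ⟨1, s, .skip s, le_rfl, h⟩

theorem Runs.instr {a : Instr} (ha : a.IsBasic) (h : Q (a.apply loss H s)) :
    Runs loss H (.instr a) s 1 Q :=
  ⟨_, _, .instr a s, (ha.cost_eq s).le, h⟩

/-- The postcondition of the first program is that the second one runs correctly from there, so
timed proofs compose in continuation style. -/
theorem Runs.seq (h : Runs loss H P s c fun s' => Runs loss H R s' c' Q) :
    Runs loss H (.seq P R) s (c + c') Q := by
  obtain ⟨τ, s', he, hτ, τ', s'', he', hτ', hq⟩ := h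
  exact ⟨_, s'', .seq he he', add_le_add hτ hτ', hq⟩

theorem Runs.ite {b : Test} (h1 : b.Holds s → Runs loss H P s c Q)
    (h2 : ¬ b.Holds s → Runs loss H R s c Q) : Runs loss H (.ite b P R) s (c + 1) Q := by
  by_cases hb : b.Holds s
  · obtain ⟨τ, s', he, hτ, hq⟩ := h1 hb
    exact ⟨_, s', .iteTrue hb he, Nat.succ_le_succ hτ, hq⟩
  · obtain ⟨τ, s', he, hτ, hq⟩ := h2 hb
    exact ⟨_, s', .iteFalse hb he, Nat.succ_le_succ hτ, hq⟩

theorem Runs.block {l : List Instr} (hl : ∀ a ∈ l, a.IsBasic)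
    (h : Q (l.foldl (fun s a => a.apply loss H s) s)) :
    Runs loss H (.block l) s (l.length + 1) Q := by
  induction l generalizing s with
  | nil => exact Runs.skip h
  | cons a l ih =>
    rw [List.length_cons, add_right_comm, add_comm]
    refine Runs.seq (Runs.instr (hl a List.mem_cons_self) ?_)
    exact ih (fun a' ha' => hl a' (List.mem_cons_of_mem _ ha')) h

theorem Runs.rep {Inv : ℕ → MachineState → Prop} (n : ℕ)
    (hstep : ∀ i s, i < n → Inv i s → Runs loss H P s c (Inv (i + 1))) (h0 : Inv 0 s) :
    Runs loss H (P.rep n) s (n * c + 1) (Inv n) := by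
  induction n with
  | zero =>
    rw [zero_mul, zero_add]
    exact Runs.skip h0
  | succ n ih =>
    rw [Nat.succ_mul, add_right_comm]
    exact Runs.seq ((ih fun i s hi => hstep i s (hi.trans n.lt_succ_self)).mono le_rfl
      fun s' hs' => hstep n s' n.lt_succ_self hs')

/-- The invariant is indexed by the number of completed passes and must decide the test, so exactly
`n` passes are made. Each pass pays one extra unit for its test, as does the final exit. -/
theorem Runs.loop {b : Test} {Inv : ℕ → MachineState → Prop} (n : ℕ)
    (hb : ∀ i s, i ≤ n → Inv i s → (b.Holds s ↔ i < n))
    (hstep : ∀ i s, i < n → Inv i s → Runs loss H P s c (Inv (i + 1))) (h0 : Inv 0 s) :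
    Runs loss H (.loop b P) s (n * (c + 1) + 1) (Inv n) := by
  have key : ∀ k i s, i + k = n → Inv i s →
      Runs loss H (.loop b P) s (k * (c + 1) + 1) (Inv n) := by
    intro k
    induction k with
    | zero =>
      intro i s hi hs
      obtain rfl : i = n := by omega
      exact ⟨1, s, .loopStop fun h => absurd ((hb i s le_rfl hs).1 h) (lt_irrefl i), by omega, hs⟩
    | succ k ih =>
      intro i s hi hs
      obtain ⟨τ, s', he, hτ, hs'⟩ := hstep i s (by omega) hs
      obtain ⟨τ', s'', he', hτ', hs''⟩ := ih (i + 1) s' (by omega) hs'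
      refine ⟨_, s'', .loopStep ((hb i s (by omega) hs).2 (by omega)) he he', ?_, hs''⟩
      rw [Nat.succ_mul]
      omega
  exact key n 0 s (zero_add n) h0

end Runs

/-! ## A program for the multiscale predictor

Natural registers: `0` the number `t` of points; `1` the constant `1`; `2, 3, 4, 5` the addresses
of four auxiliary real cells after the input; `6` the constant `d + 1`; `7, 8, 9` the index `s` of
the current point, its address, `s + 1`; `10, 11` powers of `2`; `12, 13, 14` the successor of the
index `r < s` of an earlier point, its address and the address of its label; `15, 16` the powers
`2 ^ k` and `2 ^ (k * max d 2)` for the current scale `k`; `17, 18` addresses of coordinates;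
`19` is `0` as long as no difference between the two cells has been found; `20` a counter.
The label of a point is overwritten by its correction. -/

/-- Sets register `19` to `1` if the coordinates at the addresses in registers `17`, `18` are in
different dyadic intervals of length `1 / q`, where `q` is in register `15`. -/
def compareProgram : Program :=
  .seq (.block [.natConst 20 1]) (.loop (.natLe 20 15)
    (.seq (.block [.realOfNat 2 20, .realOfNat 3 15, .realDiv 2 2 3])
      (.seq (.ite (.realLe 2 17) (.ite (.realLe 2 18) .skip (.instr (.natConst 19 1)))
          (.ite (.realLe 2 18) (.instr (.natConst 19 1)) .skip))
        (.block [.natAdd 20 20 1]))))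

/-- Compares the cells of the points at the addresses in registers `13`, `8`. -/
def sameCellProgram (d : ℕ) : Program :=
  .seq (.block [.natConst 19 0, .natCopy 17 13, .natCopy 18 8])
    (.rep (.seq compareProgram (.block [.natAdd 17 17 1, .natAdd 18 18 1])) d)

/-- Adds the correction of the earlier point, once for every common cell. -/
def scalesProgram (d : ℕ) : Program :=
  .seq (.block [.natConst 15 1, .natConst 16 1]) (.loop (.natLe 16 12)
    (.seq (sameCellProgram d) (.seq (.ite (.natLe 1 19) .skip (.instr (.realAdd 4 4 14)))
      (.seq (.block [.natAdd 15 15 15]) (.rep (.instr (.natAdd 16 16 16)) (max d 2))))))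

/-- Computes the unnormalized score of the current point. -/
def pairsProgram (d : ℕ) : Program :=
  .seq (.block [.natConst 12 1, .natConst 13 0, .realConst 4 0]) (.loop (.natLe 12 7)
    (.seq (.block [.natAdd 14 13 6, .natSub 14 14 1]) (.seq (scalesProgram d)
      (.block [.natAdd 12 12 1, .natAdd 13 13 6]))))

/-- Computes `2 ^ scale d (s + 1)`. -/
def meshProgram (d : ℕ) : Program :=
  .seq (.block [.natConst 10 1, .natConst 11 (2 ^ max d 2)]) (.loop (.natLe 11 9)
    (.seq (.block [.natAdd 10 10 10]) (.rep (.instr (.natAdd 11 11 11)) (max d 2))))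

/-- Computes all scores and corrections. -/
def scoresProgram (d : ℕ) : Program :=
  .seq (.block [.natConst 7 0, .natConst 8 0, .natConst 9 1]) (.loop (.natLe 9 0)
    (.seq (pairsProgram d) (.seq (meshProgram d)
      (.seq (.block [.realOfNat 3 10, .realDiv 5 4 3, .natAdd 10 8 6, .natSub 10 10 1])
        (.seq (.ite (.realLe 10 5) (.instr (.realConst 10 (-1))) (.instr (.realConst 10 1)))
          (.block [.natAdd 7 7 1, .natAdd 8 8 6, .natAdd 9 9 1]))))))

/-- Initializes the constant registers. -/
def setupProgram (d : ℕ) : Program :=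
  .seq (.block [.natConst 1 1, .natConst 6 (d + 1), .natConst 2 0])
    (.seq (.rep (.instr (.natAdd 2 2 0)) (d + 1))
      (.block [.natAdd 3 2 1, .natAdd 4 3 1, .natAdd 5 4 1]))

/-- Writes the score, truncated to `[0,1]`, to the first real cell. -/
def clampProgram : Program :=
  .seq (.block [.natConst 7 0, .realConst 3 0, .realConst 4 1])
    (.ite (.realLe 5 3) (.instr (.realCopy 7 3))
      (.ite (.realLe 4 5) (.instr (.realCopy 7 4)) (.instr (.realCopy 7 5))))

/-- The program for the multiscale predictor. -/
def multiscaleProgram (d : ℕ) : Program :=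
  .seq (setupProgram d) (.seq (scoresProgram d) clampProgram)

/-- The constant registers are initialized; `B` is the first address after the input. -/
structure IsSetup (d B : ℕ) (s : MachineState) : Prop where
  one : s.natMem 1 = 1
  theta : s.natMem 2 = B
  quot : s.natMem 3 = B + 1
  acc : s.natMem 4 = B + 2
  out : s.natMem 5 = B + 3
  dim : s.natMem 6 = d + 1

/-- The registers below `b` are unchanged. -/
def SameBelow (b : ℕ) (s s' : MachineState) : Prop := ∀ j < b, s'.natMem j = s.natMem j

theorem SameBelow.trans {b : ℕ} {s s' s'' : MachineState} (h : SameBelow b s s')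
    (h' : SameBelow b s' s'') : SameBelow b s s'' :=
  fun j hj => (h' j hj).trans (h j hj)

theorem SameBelow.mono {b b' : ℕ} {s s' : MachineState} (h : SameBelow b s s') (hb : b' ≤ b) :
    SameBelow b' s s' := fun j hj => h j (hj.trans_le hb)

theorem IsSetup.congr {d B : ℕ} {s s' : MachineState} (h : IsSetup d B s)
    (h' : SameBelow 7 s s') : IsSetup d B s' where
  one := (h' 1 (by norm_num)).trans h.one
  theta := (h' 2 (by norm_num)).trans h.theta
  quot := (h' 3 (by norm_num)).trans h.quot
  acc := (h' 4 (by norm_num)).trans h.acc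
  out := (h' 5 (by norm_num)).trans h.out
  dim := (h' 6 (by norm_num)).trans h.dim

/-- The real memory is unchanged outside of the `n` cells starting at `B`. -/
def SameReal (B n : ℕ) (s s' : MachineState) : Prop :=
  ∀ a, (a < B ∨ B + n ≤ a) → s'.realMem a = s.realMem a

/-- For w in [0,1] the integer ⌊q w⌋ is at most q and is determined by which of the thresholds a / q
with 1 ≤ a ≤ q lie below w. This replaces the missing floor instruction by comparisons. -/
theorem forall_div_le_iff_floor_eq {q : ℕ} (hq : 0 < q) {u v : ℝ} (hu : u ∈ I) (hv : v ∈ I) :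
    (∀ a : ℕ, 1 ≤ a → a ≤ q → ((a : ℝ) / q ≤ u ↔ (a : ℝ) / q ≤ v)) ↔
      ⌊(q : ℝ) * u⌋₊ = ⌊(q : ℝ) * v⌋₊ := by
  have hq' : (0 : ℝ) < q := by exact_mod_cast hq
  have key : ∀ w ∈ I, ∀ a : ℕ, (a : ℝ) / q ≤ w ↔ a ≤ ⌊(q : ℝ) * w⌋₊ := fun w hw a => by
    rw [Nat.le_floor_iff (mul_nonneg hq'.le hw.1), div_le_iff₀ hq', mul_comm]
  have hle : ∀ w ∈ I, ⌊(q : ℝ) * w⌋₊ ≤ q := fun w hw =>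
    Nat.floor_le_of_le (mul_le_of_le_one_right hq'.le hw.2)
  simp only [key u hu, key v hv]
  constructor
  · intro h
    refine le_antisymm ?_ ?_
    · rcases Nat.eq_zero_or_pos ⌊(q : ℝ) * u⌋₊ with h0 | h0
      · rw [h0]; exact Nat.zero_le _
      · exact (h _ h0 (hle u hu)).1 le_rfl
    · rcases Nat.eq_zero_or_pos ⌊(q : ℝ) * v⌋₊ with h0 | h0
      · rw [h0]; exact Nat.zero_le _
      · exact (h _ h0 (hle v hv)).2 le_rfl
  · intro h a _ _
    rw [h]

/-! ### Correctness and running time of the subprograms -/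

section Correctness

variable {d : ℕ} {loss : I → I → ℝ} {H : Set (Cube d → I)} {B : ℕ} {s : MachineState}

theorem runs_compareProgram (hs : IsSetup d B s) {q p₁ p₂ : ℕ} (hq : s.natMem 15 = q)
    (h₁ : s.natMem 17 = p₁) (h₂ : s.natMem 18 = p₂) (hp₁ : p₁ < B) (hp₂ : p₂ < B) :
    Runs loss H compareProgram s (10 * q + 3) fun s' => SameBelow 19 s s' ∧ SameReal B 2 s s' ∧
      (s'.natMem 19 = 0 ↔ s.natMem 19 = 0 ∧ ∀ a : ℕ, 1 ≤ a → a ≤ q →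
        ((a : ℝ) / q ≤ s.realMem p₁ ↔ (a : ℝ) / q ≤ s.realMem p₂)) := by
  let Inv : ℕ → MachineState → Prop := fun i s' => s'.natMem 20 = i + 1 ∧ SameBelow 19 s s' ∧
    SameReal B 2 s s' ∧ (s'.natMem 19 = 0 ↔ s.natMem 19 = 0 ∧ ∀ a : ℕ, 1 ≤ a → a ≤ i →
        ((a : ℝ) / q ≤ s.realMem p₁ ↔ (a : ℝ) / q ≤ s.realMem p₂))
  refine (Runs.seq (c := 2) (Runs.block (by simp [Instr.IsBasic])
    ((Runs.loop (Inv := Inv) (c := 9) q ?_ ?_ ?_).mono le_rfl fun s' h => h.2))).mono (by omega)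
    fun s' h => h
  · rintro i s' hi ⟨hi', hb, -⟩
    simp only [Test.Holds, hi', hb 15 (by norm_num), hq]
    omega
  · rintro i s' hi ⟨hi', hb, hr, h19⟩
    have hset := hs.congr (hb.mono (by norm_num))
    have e15 := (hb 15 (by norm_num)).trans hq
    have e17 := (hb 17 (by norm_num)).trans h₁
    have e18 := (hb 18 (by norm_num)).trans h₂
    have r1 := hr p₁ (Or.inl hp₁)
    have r2 := hr p₂ (Or.inl hp₂)
    refine Runs.seq (c := 4) (c' := 5) (Runs.block (by simp [Instr.IsBasic]) ?_)
    set s₁ := List.foldl (fun s a => Instr.apply loss H s a) s'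
      [.realOfNat 2 20, .realOfNat 3 15, .realDiv 2 2 3] with hs₁
    have n1 : s₁.natMem = s'.natMem := by simp [hs₁, Instr.apply]
    have hθ : s₁.realMem B = ((i + 1 : ℕ) : ℝ) / q := by
      simp [hs₁, Instr.apply, MachineState.realAt, hset.theta, hset.quot, hi', e15]
    have hrest : ∀ a, (a < B ∨ B + 2 ≤ a) → s₁.realMem a = s'.realMem a := fun a ha => by
      have h1 : a ≠ B := by omega
      have h2 : a ≠ B + 1 := by omega
      simp [hs₁, Instr.apply, hset.theta, hset.quot, h1, h2]
    have t1 : (Test.realLe 2 17).Holds s₁ ↔ ((i + 1 : ℕ) : ℝ) / q ≤ s.realMem p₁ := by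
      simp only [Test.Holds, MachineState.realAt, n1, hset.theta, e17, hθ,
        hrest p₁ (Or.inl hp₁), r1]
    have t2 : (Test.realLe 2 18).Holds s₁ ↔ ((i + 1 : ℕ) : ℝ) / q ≤ s.realMem p₂ := by
      simp only [Test.Holds, MachineState.realAt, n1, hset.theta, e18, hθ,
        hrest p₂ (Or.inl hp₂), r2]
    -- The common end of all four branches: the flag must stay unchanged when the two comparisons
    -- agree and become nonzero when they differ.
    have fin : ∀ s₂ : MachineState, s₂.realMem = s₁.realMem →
        (∀ j, j ≠ 19 → s₂.natMem j = s₁.natMem j) →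
        (s₂.natMem 19 = 0 ↔ s'.natMem 19 = 0 ∧
          (((i + 1 : ℕ) : ℝ) / q ≤ s.realMem p₁ ↔ ((i + 1 : ℕ) : ℝ) / q ≤ s.realMem p₂)) →
        Runs loss H (.block [.natAdd 20 20 1]) s₂ 2 (Inv (i + 1)) := by
      intro s₂ hr₂ hn₂ h₂
      refine Runs.block (by simp [Instr.IsBasic]) ?_
      refine ⟨?_, ?_, ?_, ?_⟩
      · simp [Instr.apply, hn₂, n1, hi', hset.one]
      · intro j hj
        have h1 : j ≠ 20 := by omega
        have h2 : j ≠ 19 := by omega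
        simp [Instr.apply, hn₂, n1, h1, h2, hb j hj]
      · intro a ha
        simp [Instr.apply, hr₂, hrest a ha, hr a ha]
      · simp only [List.foldl, Instr.apply, MachineState.natMem_setNat, 
          Nat.reduceEqDiff, if_false, h₂, h19]
        constructor
        · rintro ⟨⟨h0, hall⟩, hnew⟩
          refine ⟨h0, fun a ha1 ha2 => ?_⟩
          rcases Nat.lt_or_ge i a with hlt | hge
          · obtain rfl : a = i + 1 := by omega
            exact hnew
          · exact hall a ha1 hge
        · rintro ⟨h0, hall⟩
          exact ⟨⟨h0, fun a ha1 ha2 => hall a ha1 (by omega)⟩, hall (i + 1) (by omega) le_rfl⟩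
    refine Runs.seq (c := 3) (c' := 2) (Runs.ite (fun c1 => Runs.ite (fun c2 => ?_) fun c2 => ?_)
      fun c1 => Runs.ite (fun c2 => ?_) fun c2 => ?_)
    all_goals rw [t1] at c1; rw [t2] at c2
    · exact Runs.skip (fin s₁ rfl (fun _ _ => rfl) (by simp only [n1, c1, c2, and_true]))
    · refine Runs.instr trivial (fin _ rfl (fun j hj => by simp [Instr.apply, hj]) ?_)
      simp only [Instr.apply, MachineState.natMem_setNat, if_true, one_ne_zero, c1, c2,
          iff_false, not_true, and_false]
    · refine Runs.instr trivial (fin _ rfl (fun j hj => by simp [Instr.apply, hj]) ?_)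
      simp only [Instr.apply, MachineState.natMem_setNat, if_true, one_ne_zero, c1, c2,
          iff_true, and_false]
    · exact Runs.skip (fin s₁ rfl (fun _ _ => rfl) (by simp only [n1, c1, c2, and_true]))
  · refine ⟨by simp [Instr.apply], fun j hj => ?_, fun a _ => by simp [Instr.apply], ?_⟩
    · have : j ≠ 20 := by omega
      simp [Instr.apply, this]
    · simp [Instr.apply]
      intros
      omega

theorem runs_sameCellProgram (hs : IsSetup d B s) {k p₁ p₂ : ℕ} (hk : s.natMem 15 = 2 ^ k)
    (h₁ : s.natMem 13 = p₁) (h₂ : s.natMem 8 = p₂) (hp₁ : p₁ + d ≤ B) (hp₂ : p₂ + d ≤ B)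
    {x₁ x₂ : Cube d} (hx₁ : ∀ i : Fin d, s.realMem (p₁ + i) = x₁ i)
    (hx₂ : ∀ i : Fin d, s.realMem (p₂ + i) = x₂ i) :
    Runs loss H (sameCellProgram d) s (d * (10 * 2 ^ k + 6) + 5) fun s' =>
      SameBelow 17 s s' ∧ SameReal B 2 s s' ∧ (s'.natMem 19 = 0 ↔ cell k x₁ = cell k x₂) := by
  let Inv : ℕ → MachineState → Prop := fun i s' => s'.natMem 17 = p₁ + i ∧ s'.natMem 18 = p₂ + i ∧
    SameBelow 17 s s' ∧ SameReal B 2 s s' ∧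
      (s'.natMem 19 = 0 ↔ ∀ j : Fin d, (j : ℕ) < i → cell k x₁ j = cell k x₂ j)
  refine (Runs.seq (c := 4) (Runs.block (by simp [Instr.IsBasic])
    ((Runs.rep (Inv := Inv) (c := (10 * 2 ^ k + 3) + 3) d ?_ ?_).mono le_rfl
      fun s' h => h.2.2))).mono (by rw [Nat.add_assoc (10 * 2 ^ k)]; omega) fun s' h => ⟨h.1, h.2.1, ?_⟩
  · rintro i s' hi ⟨e17, e18, hb, hr, h19⟩
    refine Runs.seq ((runs_compareProgram (hs.congr (hb.mono (by norm_num)))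
      ((hb 15 (by norm_num)).trans hk) e17 e18 (by omega) (by omega)).mono le_rfl ?_)
    rintro s'' ⟨hb', hr', h19'⟩
    have e17' := (hb' 17 (by norm_num)).trans e17
    have e18' := (hb' 18 (by norm_num)).trans e18
    have e1 := (hs.congr ((hb.trans (hb'.mono (by norm_num))).mono (by norm_num))).one
    refine Runs.block (by simp [Instr.IsBasic]) ⟨?_, ?_, ?_, ?_, ?_⟩
    · simp [Instr.apply, e17', e1, add_assoc]
    · simp [Instr.apply, e18', e1, add_assoc]
    · intro j hj
      have n1 : j ≠ 17 := by omega
      have n2 : j ≠ 18 := by omega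
      simp [Instr.apply, n1, n2, hb' j (by omega), hb j hj]
    · intro a ha
      simp [Instr.apply, hr' a ha, hr a ha]
    · have hi₁ : s'.realMem (p₁ + i) = x₁ ⟨i, hi⟩ :=
        (hr _ (Or.inl (by omega))).trans (hx₁ ⟨i, hi⟩)
      have hi₂ : s'.realMem (p₂ + i) = x₂ ⟨i, hi⟩ :=
        (hr _ (Or.inl (by omega))).trans (hx₂ ⟨i, hi⟩)
      rw [hi₁, hi₂, forall_div_le_iff_floor_eq (by positivity) (x₁ _).2 (x₂ _).2, h19] at h19'
      have e : (List.foldl (fun s a => Instr.apply loss H s a) s''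
          [.natAdd 17 17 1, .natAdd 18 18 1]).natMem 19 = s''.natMem 19 := by
        simp [Instr.apply]
      rw [e, h19']
      push_cast
      constructor
      · rintro ⟨hall, hnew⟩ j hj
        rcases Nat.lt_succ_iff_lt_or_eq.1 hj with hlt | rfl
        · exact hall j hlt
        · exact hnew
      · exact fun hall => ⟨fun j hj => hall j (by omega), hall ⟨i, hi⟩ (by simp)⟩
  · refine ⟨by simp [Instr.apply, h₁], by simp [Instr.apply, h₂], fun j hj => ?_,
      fun a _ => by simp [Instr.apply], by simp [Instr.apply]⟩
    have n1 : j ≠ 17 := by omega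
    have n2 : j ≠ 18 := by omega
    have n3 : j ≠ 19 := by omega
    simp [Instr.apply, n1, n2, n3]
  · rw [h.2.2, funext_iff]
    exact ⟨fun h' j => h' j j.2, fun h' j _ => h' j⟩

theorem runs_rep_double {i : ℕ} (n : ℕ) {b : ℕ} (hb : b ≤ i) :
    Runs loss H (.rep (.instr (.natAdd i i i)) n) s (n + 1) fun s' => SameBelow b s s' ∧
      s'.realMem = s.realMem ∧ s'.natMem i = 2 ^ n * s.natMem i := by
  let Inv : ℕ → MachineState → Prop := fun k s' => SameBelow b s s' ∧
      s'.realMem = s.realMem ∧ s'.natMem i = 2 ^ k * s.natMem i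
  refine (Runs.rep (Inv := Inv) (c := 1) n ?_ ⟨fun _ _ => rfl, rfl, by simp⟩).mono (by omega)
    fun s' h => h
  rintro k s' _ ⟨h1, h2, h3⟩
  refine Runs.instr trivial ⟨fun j hj => ?_, h2, ?_⟩
  · have : j ≠ i := by omega
    simp [Instr.apply, this, h1 j hj]
  · simp only [Instr.apply, MachineState.natMem_setNat, if_true, h3]
    ring

/-- A time bound for `scalesProgram`. -/
def scalesCost (d t : ℕ) : ℕ := (t + 1) * (d * (10 * t + 6) + max d 2 + 11) + 4

theorem runs_scalesProgram (hs : IsSetup d B s) {t r p₁ p₂ p₃ : ℕ} (hr : r < t)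
    (h₀ : s.natMem 12 = r + 1) (h₁ : s.natMem 13 = p₁)
    (h₂ : s.natMem 8 = p₂) (h₃ : s.natMem 14 = p₃)
    (hp₁ : p₁ + d ≤ B) (hp₂ : p₂ + d ≤ B) (hp₃ : p₃ < B) {x₁ x₂ : Cube d}
    (hx₁ : ∀ i : Fin d, s.realMem (p₁ + i) = x₁ i)
    (hx₂ : ∀ i : Fin d, s.realMem (p₂ + i) = x₂ i) :
    Runs loss H (scalesProgram d) s (scalesCost d t) fun s' =>
      SameBelow 15 s s' ∧ SameReal B 3 s s' ∧
        s'.realMem (B + 2) = s.realMem (B + 2) + s.realMem p₃ * matchCount r x₁ x₂ := by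
  let Inv : ℕ → MachineState → Prop := fun i s' => s'.natMem 15 = 2 ^ i ∧
    s'.natMem 16 = (2 ^ max d 2) ^ i ∧ SameBelow 15 s s' ∧ SameReal B 3 s s' ∧
      s'.realMem (B + 2) = s.realMem (B + 2) + s.realMem p₃ *
        ((Finset.range i).filter fun k => cell k x₁ = cell k x₂).card
  -- A crude linear bound on the number of scales suffices for polynomial time.
  have hscale : scale d (r + 1) ≤ t := (Nat.log_le_self _ _).trans hr
  refine (Runs.seq (c := 3) (Runs.block (by simp [Instr.IsBasic])
    ((Runs.loop (Inv := Inv) (c := (d * (10 * t + 6) + 5) + (2 + (2 + (max d 2 + 1))))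
      (scale d (r + 1) + 1) ?_ ?_ ?_).mono le_rfl fun s' h => h.2.2))).mono ?_ fun s' h => h
  · rintro i s' hi ⟨e15, e16, hb, -⟩
    simp only [Test.Holds, e16, hb 12 (by norm_num), h₀]
    rw [← le_scale_iff (by omega), Nat.lt_succ_iff]
  · rintro i s' hi ⟨e15, e16, hb, hre, hacc⟩
    -- A scale in use satisfies 2^(iD) ≤ r + 1 ≤ t, so a comparison with 2ⁱ thresholds takes time
    -- linear in t.
    have hit : 2 ^ i ≤ t := by
      have h1 : (2 ^ max d 2) ^ i ≤ r + 1 :=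
        (le_scale_iff (by omega)).1 (Nat.lt_succ_iff.1 hi)
      have h2 : 2 ^ i ≤ (2 ^ max d 2) ^ i := Nat.pow_le_pow_left (one_lt_two_pow_max d) i
      omega
    have hset := hs.congr (hb.mono (by norm_num))
    refine Runs.seq ((runs_sameCellProgram hset e15 ((hb 13 (by norm_num)).trans h₁)
      ((hb 8 (by norm_num)).trans h₂) hp₁ hp₂
      (fun j => (hre _ (Or.inl (by omega))).trans (hx₁ j))
      (fun j => (hre _ (Or.inl (by omega))).trans (hx₂ j))).mono (by gcongr) ?_)
    rintro s₁ ⟨hb₁, hr₁, h19⟩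
    have hset₁ := hset.congr (hb₁.mono (by norm_num))
    have hacc₁ : s₁.realMem (B + 2) = s'.realMem (B + 2) := hr₁ _ (Or.inr le_rfl)
    have fin : ∀ s₂ : MachineState, s₂.natMem = s₁.natMem →
        (∀ a, a ≠ B + 2 → s₂.realMem a = s₁.realMem a) →
        s₂.realMem (B + 2) = s₁.realMem (B + 2)
          + s.realMem p₃ * (if cell i x₁ = cell i x₂ then 1 else 0) →
        Runs loss H (.seq (.block [.natAdd 15 15 15]) (.rep (.instr (.natAdd 16 16 16)) (max d 2)))
          s₂ (2 + (max d 2 + 1)) (Inv (i + 1)) := by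
      intro s₂ hn₂ hr₂ ha₂
      refine Runs.seq (Runs.block (by simp [Instr.IsBasic])
        ((runs_rep_double (max d 2) (le_refl 16)).mono le_rfl ?_))
      rintro s₃ ⟨hb₃, hr₃, h16⟩
      refine ⟨?_, ?_, ?_, ?_, ?_⟩
      · rw [hb₃ 15 (by norm_num)]
        simp only [List.foldl, Instr.apply, MachineState.natMem_setNat, if_true, hn₂,
          hb₁ 15 (by norm_num), e15]
        ring
      · rw [h16]
        simp only [List.foldl, Instr.apply, MachineState.natMem_setNat, hn₂,
          hb₁ 16 (by norm_num), e16]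
        norm_num
        ring
      · intro j hj
        have n1 : j ≠ 15 := by omega
        rw [hb₃ j (by omega)]
        simp [Instr.apply, n1, hn₂, hb₁ j (by omega), hb j hj]
      · intro a ha
        rw [hr₃]
        simp only [List.foldl, Instr.apply, MachineState.realMem_setNat]
        rw [hr₂ a (by omega), hr₁ a (by omega), hre a ha]
      · rw [hr₃]
        simp only [List.foldl, Instr.apply, MachineState.realMem_setNat]
        rw [ha₂, hacc₁, hacc, Finset.range_add_one, Finset.filter_insert]
        split_ifs with hc
        · rw [Finset.card_insert_of_notMem (by simp)]
          push_cast
          ring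
        · ring
    have htest : (Test.natLe 1 19).Holds s₁ ↔ cell i x₁ ≠ cell i x₂ := by
      rw [ne_eq, ← h19]
      simp only [Test.Holds, hset₁.one]
      omega
    refine Runs.seq (c := 2) (Runs.ite (fun hc => ?_) fun hc => ?_)
    · rw [htest] at hc
      exact Runs.skip (fin s₁ rfl (fun _ _ => rfl) (by simp [hc]))
    · rw [htest, not_not] at hc
      have e14 : s₁.natMem 14 = p₃ :=
        (hb₁ 14 (by norm_num)).trans ((hb 14 (by norm_num)).trans h₃)
      have g : s₁.realMem p₃ = s.realMem p₃ :=
        (hr₁ _ (Or.inl hp₃)).trans (hre _ (Or.inl hp₃))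
      refine Runs.instr trivial (fin _ rfl (fun a ha => ?_) ?_)
      · simp [Instr.apply, hset₁.acc, ha]
      · simp [Instr.apply, hset₁.acc, MachineState.realAt, e14, g, hc]
  · refine ⟨by simp [Instr.apply], by simp [Instr.apply], fun j hj => ?_,
      fun a _ => by simp [Instr.apply], by simp [Instr.apply]⟩
    have n1 : j ≠ 15 := by omega
    have n2 : j ≠ 16 := by omega
    simp [Instr.apply, n1, n2]
  · rw [scalesCost]
    have : (scale d (r + 1) + 1) * (d * (10 * t + 6) + 5 + (2 + (2 + (max d 2 + 1))) + 1) ≤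
        (t + 1) * (d * (10 * t + 6) + max d 2 + 11) :=
      Nat.mul_le_mul (by omega) (by omega)
    omega

/-- The first `t` cells of the input hold the points `x`, with the labels `y` replaced by their
corrections at the indices smaller than `s`. -/
structure Holds (t n : ℕ) (x : ℕ → Cube d) (y : ℕ → ℝ) (s : MachineState) : Prop where
  point : ∀ i < t, ∀ k : Fin d, s.realMem (i * (d + 1) + k) = x i k
  corrected : ∀ i < n, s.realMem (i * (d + 1) + d) = correction x y i
  label : ∀ i < t, n ≤ i → s.realMem (i * (d + 1) + d) = y i

theorem mul_succ_add_le {t i : ℕ} (h : i < t) (d : ℕ) : i * (d + 1) + d + 1 ≤ t * (d + 1) := by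
  calc i * (d + 1) + d + 1 = (i + 1) * (d + 1) := by ring
    _ ≤ t * (d + 1) := Nat.mul_le_mul_right _ h

theorem Holds.congr {t n m : ℕ} {x : ℕ → Cube d} {y : ℕ → ℝ} {s s' : MachineState}
    (h : Holds t n x y s) (hn : n ≤ t) (h' : SameReal (t * (d + 1)) m s s') :
    Holds t n x y s' where
  point i hi k := by
    have := mul_succ_add_le hi d
    rw [h' _ (Or.inl (by omega)), h.point i hi k]
  corrected i hi := by
    have := mul_succ_add_le (hi.trans_le hn) d
    rw [h' _ (Or.inl (by omega)), h.corrected i hi]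
  label i hi hi' := by
    have := mul_succ_add_le hi d
    rw [h' _ (Or.inl (by omega)), h.label i hi hi']

/-- A time bound for `pairsProgram`. -/
def pairsCost (d t : ℕ) : ℕ := t * (scalesCost d t + 7) + 5

theorem runs_pairsProgram {t n : ℕ} (hs : IsSetup d (t * (d + 1)) s) {x : ℕ → Cube d}
    {y : ℕ → ℝ} (hn : n < t) (hmem : Holds t n x y s) (h₇ : s.natMem 7 = n)
    (h₈ : s.natMem 8 = n * (d + 1)) :
    Runs loss H (pairsProgram d) s (pairsCost d t) fun s' =>
      SameBelow 12 s s' ∧ SameReal (t * (d + 1)) 3 s s' ∧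
        s'.realMem (t * (d + 1) + 2) =
          ∑ r ∈ Finset.range n, correction x y r * matchCount r (x r) (x n) := by
  let Inv : ℕ → MachineState → Prop := fun r s' => s'.natMem 12 = r + 1 ∧
    s'.natMem 13 = r * (d + 1) ∧ SameBelow 12 s s' ∧ SameReal (t * (d + 1)) 3 s s' ∧
      s'.realMem (t * (d + 1) + 2) =
          ∑ r ∈ Finset.range r, correction x y r * matchCount r (x r) (x n)
  refine (Runs.seq (c := 4) (Runs.block (by simp [Instr.IsBasic])
    ((Runs.loop (Inv := Inv) (c := 3 + (scalesCost d t + 3)) n ?_ ?_ ?_).mono le_rfl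
      fun s' h => h.2.2))).mono ?_ fun s' h => h
  · rintro i s' hi ⟨e12, e13, hb, -⟩
    simp only [Test.Holds, e12, hb 7 (by norm_num), h₇]
    omega
  · rintro r s' hr ⟨e12, e13, hb, hre, hacc⟩
    have hset := hs.congr (hb.mono (by norm_num))
    have hrt := mul_succ_add_le (hr.trans hn) d
    have hnt := mul_succ_add_le hn d
    refine Runs.seq (Runs.block (by simp [Instr.IsBasic]) ?_)
    set s₁ := List.foldl (fun s a => Instr.apply loss H s a) s'
      [.natAdd 14 13 6, .natSub 14 14 1] with hs₁
    have hb₁ : SameBelow 14 s' s₁ := fun j hj => by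
      have n1 : j ≠ 14 := by omega
      simp [hs₁, Instr.apply, n1]
    have hr₁ : s₁.realMem = s'.realMem := by simp [hs₁, Instr.apply]
    have h14 : s₁.natMem 14 = r * (d + 1) + d := by
      simp [hs₁, Instr.apply, e13, hset.dim, hset.one]
    have hset₁ := hset.congr (hb₁.mono (by norm_num))
    have hmem' := hmem.congr hn.le hre
    refine Runs.seq ((runs_scalesProgram hset₁ (hr.trans hn)
      ((hb₁ 12 (by norm_num)).trans e12) ((hb₁ 13 (by norm_num)).trans e13)
      ((hb₁ 8 (by norm_num)).trans ((hb 8 (by norm_num)).trans h₈)) h14 (by omega) (by omega)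
      (by omega) (x₁ := x r) (x₂ := x n)
      (fun i => by rw [hr₁, hmem'.point r (hr.trans hn)])
      (fun i => by rw [hr₁, hmem'.point n hn])).mono le_rfl ?_)
    rintro s₂ ⟨hb₂, hr₂, ha₂⟩
    rw [hr₁, hacc, hmem'.corrected r hr] at ha₂
    have hset₂ := hset₁.congr (hb₂.mono (by norm_num))
    refine Runs.block (by simp [Instr.IsBasic]) ⟨?_, ?_, ?_, ?_, ?_⟩
    · simp [Instr.apply, hb₂ 12 (by norm_num), hb₁ 12 (by norm_num), e12, hset₂.one]
    · simp [Instr.apply, hb₂ 13 (by norm_num), hb₁ 13 (by norm_num), e13, hset₂.dim]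
      ring
    · intro j hj
      have n1 : j ≠ 12 := by omega
      have n2 : j ≠ 13 := by omega
      simp [Instr.apply, n1, n2, hb₂ j (by omega), hb₁ j (by omega), hb j hj]
    · intro a ha
      simp only [List.foldl, Instr.apply, MachineState.realMem_setNat]
      rw [hr₂ a ha, hr₁, hre a ha]
    · simp only [List.foldl, Instr.apply, MachineState.realMem_setNat]
      rw [ha₂, Finset.sum_range_succ]
  · refine ⟨by simp [Instr.apply], by simp [Instr.apply], fun j hj => ?_, fun a ha => ?_, ?_⟩
    · have n1 : j ≠ 12 := by omega
      have n2 : j ≠ 13 := by omega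
      simp [Instr.apply, n1, n2]
    · have n1 : a ≠ t * (d + 1) + 2 := by omega
      simp [Instr.apply, hs.acc, n1]
    · simp [Instr.apply, hs.acc]
  · rw [pairsCost]
    have : n * (3 + (scalesCost d t + 3) + 1) ≤ t * (scalesCost d t + 7) :=
      Nat.mul_le_mul hn.le (by omega)
    omega

/-- A time bound for `meshProgram`. -/
def meshCost (d t : ℕ) : ℕ := t * (max d 2 + 4) + 4

theorem runs_meshProgram {t n : ℕ} (hn : n < t) (h₉ : s.natMem 9 = n + 1) :
    Runs loss H (meshProgram d) s (meshCost d t) fun s' =>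
      SameBelow 10 s s' ∧ s'.realMem = s.realMem ∧ s'.natMem 10 = 2 ^ scale d (n + 1) := by
  let Inv : ℕ → MachineState → Prop := fun i s' => s'.natMem 11 = (2 ^ max d 2) ^ (i + 1) ∧
    SameBelow 10 s s' ∧ s'.realMem = s.realMem ∧ s'.natMem 10 = 2 ^ i
  have hscale : scale d (n + 1) ≤ t := (Nat.log_le_self _ _).trans hn
  refine (Runs.seq (c := 3) (Runs.block (by simp [Instr.IsBasic])
    ((Runs.loop (Inv := Inv) (c := 2 + (max d 2 + 1)) (scale d (n + 1)) ?_ ?_ ?_).mono le_rfl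
      fun s' h => h.2))).mono ?_ fun s' h => h
  · rintro i s' hi ⟨e11, hb, -⟩
    simp only [Test.Holds, e11, hb 9 (by norm_num), h₉]
    rw [← le_scale_iff (by omega), Nat.succ_le_iff]
  · rintro i s' hi ⟨e11, hb, hr, e10⟩
    refine Runs.seq (Runs.block (by simp [Instr.IsBasic])
      ((runs_rep_double (max d 2) (le_refl 11)).mono le_rfl ?_))
    rintro s₂ ⟨hb₂, hr₂, h₂⟩
    refine ⟨?_, fun j hj => ?_, ?_, ?_⟩
    · rw [h₂]
      simp [Instr.apply, e11]
      ring
    · have n1 : j ≠ 10 := by omega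
      rw [hb₂ j (by omega)]
      simp [Instr.apply, n1, hb j hj]
    · rw [hr₂]
      simp [Instr.apply, hr]
    · rw [hb₂ 10 (by norm_num)]
      simp [Instr.apply, e10]
      ring
  · refine ⟨by simp [Instr.apply], fun j hj => ?_, by simp [Instr.apply], by simp [Instr.apply]⟩
    have n1 : j ≠ 10 := by omega
    have n2 : j ≠ 11 := by omega
    simp [Instr.apply, n1, n2]
  · rw [meshCost]
    have : scale d (n + 1) * (2 + (max d 2 + 1) + 1) ≤ t * (max d 2 + 4) :=
      Nat.mul_le_mul hscale (by omega)
    omega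

/-- A time bound for `scoresProgram`. -/
def scoresCost (d t : ℕ) : ℕ := t * (pairsCost d t + meshCost d t + 12) + 5

/-- The last point is treated like the others, using whatever its label cell holds. This is
harmless: its score depends only on earlier corrections and is computed before the label is read. -/
theorem runs_scoresProgram {t : ℕ} (ht : 0 < t) (hs : IsSetup d (t * (d + 1)) s)
    {x : ℕ → Cube d} {y : ℕ → ℝ} (hmem : Holds t 0 x y s) (h₀ : s.natMem 0 = t) :
    Runs loss H (scoresProgram d) s (scoresCost d t) fun s' =>
      SameBelow 7 s s' ∧ s'.realMem (t * (d + 1) + 3) = score x y (t - 1) := by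
  let Inv : ℕ → MachineState → Prop := fun n s' => s'.natMem 7 = n ∧
    s'.natMem 8 = n * (d + 1) ∧ s'.natMem 9 = n + 1 ∧ Holds t n x y s' ∧
      SameBelow 7 s s' ∧ (0 < n → s'.realMem (t * (d + 1) + 3) = score x y (n - 1))
  refine (Runs.seq (c := 4) (Runs.block (by simp [Instr.IsBasic])
    ((Runs.loop (Inv := Inv) (c := pairsCost d t + (meshCost d t + (5 + (2 + 4)))) t
      ?_ ?_ ?_).mono le_rfl
      fun s' h => ⟨h.2.2.2.2.1, h.2.2.2.2.2 ht⟩))).mono ?_ fun s' h => h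
  · rintro i s' hi ⟨-, -, e9, -, hb, -⟩
    simp only [Test.Holds, e9, hb 0 (by norm_num), h₀]
    omega
  · rintro n s' hn ⟨e7, e8, e9, hm, hb, -⟩
    have hset := hs.congr hb
    have hnt := mul_succ_add_le hn d
    refine Runs.seq ((runs_pairsProgram hset hn hm e7 e8).mono le_rfl ?_)
    rintro s₁ ⟨hb₁, hr₁, ha₁⟩
    refine Runs.seq ((runs_meshProgram (d := d) hn ((hb₁ 9 (by norm_num)).trans e9)).mono
      le_rfl ?_)
    rintro s₂ ⟨hb₂, hr₂, h10⟩
    have hb₁₂ : SameBelow 10 s' s₂ := (hb₁.mono (by norm_num)).trans hb₂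
    have hset₂ := hset.congr (hb₁₂.mono (by norm_num))
    have hm₂ : Holds t n x y s₂ := hm.congr hn.le (fun a ha => by rw [hr₂, hr₁ a ha])
    refine Runs.seq (Runs.block (by simp [Instr.IsBasic]) ?_)
    set s₃ := List.foldl (fun s a => Instr.apply loss H s a) s₂
      [.realOfNat 3 10, .realDiv 5 4 3, .natAdd 10 8 6, .natSub 10 10 1] with hs₃
    have hb₃ : SameBelow 10 s₂ s₃ := fun j hj => by
      have n1 : j ≠ 10 := by omega
      simp [hs₃, Instr.apply, n1]
    have h10₃ : s₃.natMem 10 = n * (d + 1) + d := by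
      simp [hs₃, Instr.apply, hb₁₂ 8 (by norm_num), e8, hset₂.dim, hset₂.one]
    have hr₃ : SameReal (t * (d + 1)) 4 s₂ s₃ := fun a ha => by
      have n1 : a ≠ t * (d + 1) + 1 := by omega
      have n2 : a ≠ t * (d + 1) + 3 := by omega
      simp [hs₃, Instr.apply, hset₂.quot, hset₂.out, n1, n2]
    have hscore : s₃.realMem (t * (d + 1) + 3) = score x y n := by
      simp [hs₃, Instr.apply, MachineState.realAt, hset₂.quot, hset₂.out, hset₂.acc, h10, hr₂, ha₁,
        score]
    have hset₃ := hset₂.congr (hb₃.mono (by norm_num))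
    have hm₃ : Holds t n x y s₃ := hm₂.congr hn.le hr₃
    have htest : (Test.realLe 10 5).Holds s₃ ↔ y n ≤ score x y n := by
      simp only [Test.Holds, MachineState.realAt, h10₃, hset₃.out, hscore, hm₃.label n hn le_rfl]
    have fin : ∀ s₄ : MachineState, s₄.natMem = s₃.natMem →
        (∀ a, s₄.realMem a = if a = n * (d + 1) + d then correction x y n else s₃.realMem a) →
        Runs loss H (.block [.natAdd 7 7 1, .natAdd 8 8 6, .natAdd 9 9 1]) s₄ 4
          (Inv (n + 1)) := by
      intro s₄ hn₄ hr₄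
      have hb₄ : ∀ j < 10, s₄.natMem j = s'.natMem j := fun j hj => by
        rw [hn₄, hb₃ j hj, hb₁₂ j hj]
      refine Runs.block (by simp [Instr.IsBasic]) ⟨?_, ?_, ?_, ⟨?_, ?_, ?_⟩, ?_, ?_⟩
      · simp [Instr.apply, hb₄, e7, hset.one]
      · simp [Instr.apply, hb₄, e8, hset.dim]
        ring
      · simp [Instr.apply, hb₄, e9, hset.one]
      · intro i hi k
        simp only [List.foldl, Instr.apply, MachineState.realMem_setNat]
        rw [hr₄, if_neg, hm₃.point i hi k]
        intro h
        -- Modulo d + 1 a coordinate address is less than d and a label address is d, so writing a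
        -- correction never damages a point.
        have h' := congrArg (· % (d + 1)) h
        simp only [Nat.mul_add_mod_self_right] at h'
        rw [Nat.mod_eq_of_lt (by omega), Nat.mod_eq_of_lt (by omega)] at h'
        omega
      · intro i hi
        simp only [List.foldl, Instr.apply, MachineState.realMem_setNat]
        rw [hr₄]
        rcases Nat.lt_succ_iff_lt_or_eq.1 hi with hlt | rfl
        · have := mul_succ_add_le hlt d
          rw [if_neg (by omega), hm₃.corrected i hlt]
        · rw [if_pos rfl]
      · intro i hi hi'
        simp only [List.foldl, Instr.apply, MachineState.realMem_setNat]
        have := mul_succ_add_le (show n < i by omega) d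
        rw [hr₄, if_neg (by omega), hm₃.label i hi (by omega)]
      · intro j hj
        have n1 : j ≠ 7 := by omega
        have n2 : j ≠ 8 := by omega
        have n3 : j ≠ 9 := by omega
        simp [Instr.apply, n1, n2, n3, hb₄ j (by omega), hb j hj]
      · intro _
        simp only [List.foldl, Instr.apply, MachineState.realMem_setNat]
        rw [hr₄, if_neg (by omega), hscore, Nat.add_sub_cancel]
    refine Runs.seq (c := 2) (Runs.ite (fun hc => ?_) fun hc => ?_)
    · rw [htest] at hc
      refine Runs.instr trivial (fin _ rfl fun a => ?_)
      simp [Instr.apply, h10₃, correction_eq x y n, hc]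
    · rw [htest] at hc
      refine Runs.instr trivial (fin _ rfl fun a => ?_)
      simp [Instr.apply, h10₃, correction_eq x y n, hc]
  · refine ⟨by simp [Instr.apply], by simp [Instr.apply], by simp [Instr.apply], ?_,
      fun j hj => ?_, fun h => absurd h (lt_irrefl 0)⟩
    · exact hmem.congr (Nat.zero_le _) (m := 0) fun a _ => by simp [Instr.apply]
    · have n1 : j ≠ 7 := by omega
      have n2 : j ≠ 8 := by omega
      have n3 : j ≠ 9 := by omega
      simp [Instr.apply, n1, n2, n3]
  · rw [scoresCost]
    have : t * (pairsCost d t + (meshCost d t + (5 + (2 + 4))) + 1) =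
        t * (pairsCost d t + meshCost d t + 12) := by ring
    omega

theorem runs_setupProgram {t : ℕ} (h₀ : s.natMem 0 = t) :
    Runs loss H (setupProgram d) s (d + 10) fun s' =>
      IsSetup d (t * (d + 1)) s' ∧ s'.natMem 0 = t ∧ s'.realMem = s.realMem := by
  let Inv : ℕ → MachineState → Prop := fun i s' => s'.natMem 2 = t * i ∧ s'.natMem 0 = t ∧
    s'.natMem 1 = 1 ∧ s'.natMem 6 = d + 1 ∧ s'.realMem = s.realMem
  refine (Runs.seq (c := 4) (Runs.block (by simp [Instr.IsBasic])
    (Runs.seq ((Runs.rep (Inv := Inv) (c := 1) (d + 1) ?_ ?_).mono le_rfl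
      fun s' h => Runs.block (by simp [Instr.IsBasic]) ?_)))).mono (by simp; omega) fun s' h => h
  · rintro i s' _ ⟨h2, h0, h1, h6, hr⟩
    refine Runs.instr trivial ⟨?_, ?_, ?_, ?_, ?_⟩
    · simp [Instr.apply, h2, h0]
      ring
    all_goals simpa [Instr.apply]
  · refine ⟨?_, ?_, ?_, ?_, ?_⟩ <;> simp [Instr.apply, h₀]
  · obtain ⟨h2, h0, h1, h6, hr⟩ := h
    refine ⟨⟨?_, ?_, ?_, ?_, ?_, ?_⟩, ?_, ?_⟩ <;> simp [Instr.apply, h0, h1, h2, h6, hr]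

theorem runs_clampProgram (hs : IsSetup d B s) {p : ℝ}
    (hp : s.realMem (B + 3) = p) :
    Runs loss H clampProgram s 7 fun s' =>
      s'.realMem 0 = (Set.projIcc (0 : ℝ) 1 zero_le_one p : I) := by
  refine Runs.seq (c := 4) (c' := 3) (Runs.block (by simp [Instr.IsBasic]) ?_)
  set s₁ := List.foldl (fun s a => Instr.apply loss H s a) s
    [.natConst 7 0, .realConst 3 0, .realConst 4 1] with hs₁
  have n3 : s₁.natMem 3 = B + 1 := by simp [hs₁, Instr.apply, hs.quot]
  have n4 : s₁.natMem 4 = B + 2 := by simp [hs₁, Instr.apply, hs.acc]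
  have n5 : s₁.natMem 5 = B + 3 := by simp [hs₁, Instr.apply, hs.out]
  have n7 : s₁.natMem 7 = 0 := by simp [hs₁, Instr.apply]
  have r3 : s₁.realMem (B + 1) = 0 := by simp [hs₁, Instr.apply, hs.quot, hs.acc]
  have r4 : s₁.realMem (B + 2) = 1 := by simp [hs₁, Instr.apply, hs.acc]
  have r5 : s₁.realMem (B + 3) = p := by simp [hs₁, Instr.apply, hs.quot, hs.acc, hp]
  refine Runs.ite (c := 2) (fun h1 => ?_) fun h1 => Runs.ite (c := 1) (fun h2 => ?_) fun h2 => ?_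
  · simp only [Test.Holds, MachineState.realAt, n3, n5, r3, r5] at h1
    refine (Runs.instr (a := .realCopy 7 3) trivial ?_).mono one_le_two fun s' h => h
    simp [Instr.apply, MachineState.realAt, n7, n3, r3, Set.projIcc_of_le_left _ h1]
  · simp only [Test.Holds, MachineState.realAt, n4, n5, r4, r5] at h2
    refine Runs.instr trivial ?_
    simp [Instr.apply, MachineState.realAt, n7, n4, r4, Set.projIcc_of_right_le _ h2]
  · simp only [Test.Holds, MachineState.realAt, n3, n4, n5, r3, r4, r5, not_le] at h1 h2
    refine Runs.instr trivial ?_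
    simp [Instr.apply, MachineState.realAt, n7, n5, r5,
      Set.projIcc_of_mem zero_le_one ⟨h1.le, h2.le⟩]

theorem holds_startState (past : List (Cube d × I)) (x : Cube d) (ω : ℕ → Bool) :
    Holds (past.length + 1) 0 (fun i => (past.map Prod.fst ++ [x]).getD i 0)
      (fun i => ((past.map Prod.snd).getD i 0 : I)) (startState past x ω) where
  point i hi k := by
    have h1 : (i * (d + 1) + k) % (d + 1) = k := by
      rw [Nat.mul_add_mod_self_right, Nat.mod_eq_of_lt (by omega)]
    have h2 : (i * (d + 1) + k) / (d + 1) = i := by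
      rw [Nat.div_eq_iff d.succ_pos]
      constructor <;> simp
    have h3 : i < (past.map Prod.fst ++ [x]).length := by simpa using hi
    simp only [startState, h1, h2, k.2, dif_pos, List.getD_eq_getElem?_getD,
      List.getElem?_eq_getElem h3, Option.getD_some]
  corrected i hi := absurd hi (Nat.not_lt_zero i)
  label i hi _ := by
    have h1 : (i * (d + 1) + d) % (d + 1) = d := by
      rw [Nat.mul_add_mod_self_right, Nat.mod_eq_of_lt (by omega)]
    have h2 : (i * (d + 1) + d) / (d + 1) = i := by
      rw [Nat.div_eq_iff d.succ_pos]
      constructor <;> simp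
    simp only [startState, h1, h2, lt_irrefl, dif_neg, not_false_iff, List.getD_eq_getElem?_getD]
    cases (past.map Prod.snd)[i]? <;> simp

theorem runs_multiscaleProgram (past : List (Cube d × I)) (x : Cube d) (ω : ℕ → Bool) :
    Runs loss H (multiscaleProgram d) (startState past x ω)
      (scoresCost d (past.length + 1) + (d + 17)) fun s' =>
        s'.realMem 0 = multiscale past x := by
  have h₀ : (startState past x ω).natMem 0 = past.length + 1 := by simp [startState]
  refine (Runs.seq ((runs_setupProgram h₀).mono le_rfl ?_)).mono
    (c := d + 10 + (scoresCost d (past.length + 1) + 7)) (by omega) fun s' h => h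
  rintro s₁ ⟨hset, h0, hr⟩
  refine Runs.seq ((runs_scoresProgram (Nat.succ_pos _) hset
    ((holds_startState past x ω).congr (Nat.zero_le _) (m := 0) fun a _ => by rw [hr])
    h0).mono le_rfl ?_)
  rintro s₂ ⟨hb, hp⟩
  exact runs_clampProgram (hset.congr hb) hp

/-- The loss and the class are arbitrary here because the program makes no oracle call. The output
ignores the coins, so the image of the coin measure is a Dirac measure. -/
theorem isOracleEfficient_multiscale :
    IsOracleEfficient loss H (diracRule (multiscale (d := d))) := by
  have hscales : ∃ p : Polynomial ℕ, ∀ t, p.eval t = scalesCost d t :=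
    ⟨(.X + 1) * (.C d * (10 * .X + 6) + .C (max d 2) + 11) + 4, fun t => by
      simp [scalesCost]⟩
  obtain ⟨p, hp⟩ := hscales
  refine ⟨multiscaleProgram d, .X * ((.X * (p + 7) + 5) + (.X * (.C (max d 2) + 4) + 4) + 12) + 5
    + (.C d + 17), fun past x _ => multiscale past x, fun past x ω => ?_, fun past x => ?_⟩
  · obtain ⟨τ, s', he, hτ, hs'⟩ := runs_multiscaleProgram (loss := loss) (H := H) past x ω
    refine ⟨τ, s', he, hτ.trans (le_of_eq ?_), hs'⟩
    simp [scoresCost, pairsCost, meshCost, hp]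
  · have : IsProbabilityMeasure coinMeasure := by
      unfold coinMeasure
      infer_instance
    rw [Measure.map_const, measure_univ, one_smul]
    rfl

end Correctness

end

theorem theorem3p11 (d : ℕ) (hd : 1 ≤ d) :
    (∃ Φ : PredictionRule (Cube d),
      IsOracleEfficient absLoss (lipschitzClass d) Φ ∧
      ∃ (C : ℝ) (k : ℕ), ∀ T : ℕ, 1 ≤ T →
        hybridRegret absLoss (lipschitzClass d) Φ T ≤
          C * (T : ℝ) ^ (max (1 / 2 : ℝ) (((d : ℝ) - 1) / (d : ℝ))) * (1 + Real.log T) ^ k) ∧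
    (∃ (c : ℝ) (k : ℕ), 0 < c ∧ ∀ T : ℕ, 1 ≤ T → ∀ Φ : PredictionRule (Cube d),
      c * (T : ℝ) ^ (max (1 / 2 : ℝ) (((d : ℝ) - 1) / (d : ℝ))) / (1 + Real.log T) ^ k ≤
        hybridRegret absLoss (lipschitzClass d) Φ T) := by
  change (∃ Φ : PredictionRule (Cube d), IsOracleEfficient absLoss (lipschitzClass d) Φ ∧
      ∃ (C : ℝ) (k : ℕ), ∀ T : ℕ, 1 ≤ T → hybridRegret absLoss (lipschitzClass d) Φ T ≤
          C * (T : ℝ) ^ rateExponent d * (1 + Real.log T) ^ k) ∧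
    ∃ (c : ℝ) (k : ℕ), 0 < c ∧ ∀ T : ℕ, 1 ≤ T → ∀ Φ : PredictionRule (Cube d),
      c * (T : ℝ) ^ rateExponent d / (1 + Real.log T) ^ k ≤
        hybridRegret absLoss (lipschitzClass d) Φ T
  -- One logarithm is lost in the upper bound and none in the lower bound.
  refine ⟨⟨diracRule multiscale, isOracleEfficient_multiscale, 2 ^ d + 6, 1, fun T hT => ?_⟩,
    1 / (4 * 2 ^ d), 0, by positivity, fun T hT Φ => ?_⟩
  · rw [pow_one]
    exact hybridRegret_diracRule_le (lipschitzClass_nonempty d) multiscale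
      fun x y => realizedRegret_multiscale_le hd hT x y
  · rw [pow_zero, div_one, div_mul_eq_mul_div, one_mul]
    exact rpow_le_hybridRegret hd hT Φ
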